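/- **Setting.** Let $n\ge 2$. A matrix $W\in\mathbb R^{n\times n}$ is a *gossip matrix* of an undirected graph $\mathcal G$ on $\{1,\dots,n\}$ if $W_{ij}=0$ whenever $i\ne j$ and $(i,j)$ is not an edge of $\mathcal G$, and $\ker W=\{x\in\mathbb R^n: x_1=\dots=x_n\}$. Let $W_G\subset\mathbb R^{n\times n}$ be a set of matrices, each a gossip matrix of some graph and each satisfying $\mathbf 1^\top W=0$ (as holds for symmetric gossip matrices), equipped with a $\sigma$-field for which the matrix entries are measurable. Assume: 1. $(W_k)_{k\ge 0}$ is a stationary time-homogeneous Markov chain on $W_G$ with Markov kernel $Q$ and unique invariant distribution $\pi$, and for some integer $\tau\ge1$ and every $m\in\mathbb N$, $$\sup_{W,W'\in W_G}\tfrac12\|Q^m(W,\cdot)-Q^m(W',\cdot)\|_{\mathrm{TV}}\le (1/4)^{\lfloor m/\tau\rfloor},$$ where $\|\cdot\|_{\mathrm{TV}}$ is the total variation norm of a signed measure. 2. $\mathbb E_\pi[W_k]=\tilde W$, where $\tilde W$ is symmetric positive semidefinite and is a gossip matrix of some connected graph. Let $\lambda_{\max}$ be its largest and $\lambda_{\min}$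 its smallest positive eigenvalue. 3. $\|W-\tilde W\|\le\rho$ in the spectral norm for all $W\in W_G$. For $x^0\in\mathbb R^n$ consider the problem of minimizing $r(x)=\|\sqrt{\tilde W}x\|^2$ subject to $\sum_j x_{(j)}=\sum_j x^0_{(j)}$, and let $x^*_{(i)}=\frac1n\sum_j x^0_{(j)}$ for all $i$. **Algorithm.** Given $\gamma,\theta,\eta,\beta,p,M\in\mathbb R$ and $B\in\mathbb N$, let $(J_k)_{k\ge0}$ be i.i.d., independent of the chain, with $\mathbb P(J_k=j)=2^{-j}$ for $j\ge 1$. Put $x^0_f=x^0$, $T^0=0$ and, for $k\ge0$, $$x_g^k=\theta x_f^k+(1-\theta)x^k,\qquad g_j^k=2^{-j}B^{-1}\sum_{i=1}^{2^jB}W_{T^k+i}\,x_g^k,$$ $$g^k=g_0^k+\begin{cases}2^{J_k}(g^k_{J_k}-g^k_{J_k-1}),&2^{J_k}\le M,\\0,&\text{otherwise,}\end{cases}\qquad x_f^{k+1}=x_g^k-p\gamma g^k,$$ $$x^{k+1}=\eta x_f^{k+1}+(p-\eta)x_f^k+(1-p)(1-\beta)x^k+(1-p)\beta x_g^k,\qquad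 T^{k+1}=T^k+2^{J_k}B.$$ **Theorem.** There is an absolute constant $C>0$ such that the following holds in every such setting. For every integer $b\ge1$, every $$0<\gamma<\min\left\{\frac{3}{4\lambda_{\max}},\ \frac{\lambda_{\min}^3}{[1800\rho^2(\tau b^{-1}+\tau^2b^{-2})]^2}\right\}$$ (the second bound being $+\infty$ if $\rho=0$), and the parameters $$p=\tfrac14,\quad \beta=\sqrt{\tfrac{4p^2\lambda_{\min}\gamma}{3}},\quad \eta=\frac{3\beta}{p\lambda_{\min}\gamma}=\sqrt{\tfrac{12}{\lambda_{\min}\gamma}},\quad \theta=\frac{p\eta^{-1}-1}{\beta p\eta^{-1}-1},$$ $$M=\max\left\{2,\sqrt{\tfrac14\left(1+\tfrac2\beta\right)}\right\},\qquad B=\lceil b\log_2M\rceil,$$ for every $x^0\in\mathbb R^n$ and every $N\in\mathbb N\cup\{0\}$ the random variable below is integrable and $$\mathbb E\left[\|x^N-x^*\|^2+\tfrac{24}{\lambda_{\min}}\bigl(r(x^N_f)-r(x^*)\bigr)\right]\le C\exp\left(-N\sqrt{\tfrac{p^2\lambda_{\min}\gamma}{3}}\right)\left[\|x^0-x^*\|^2+\tfrac{24}{\lambda_{\min}}\bigl(r(x^0)-r(x^*)\bigr)\right].$$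 -/

import Mathlib

open MeasureTheory ProbabilityTheory
open scoped ENNReal MatrixOrder Matrix

noncomputable section

/-- `W` is a gossip matrix of the graph `G` on the nodes `Fin n`: off-diagonal entries vanish on
non-edges, and the kernel of `W` is exactly the set of vectors with equal coordinates. -/
structure IsGossipMatrix {n : ℕ} (G : SimpleGraph (Fin n)) (W : Matrix (Fin n) (Fin n) ℝ) :
    Prop where
  eq_zero_of_not_adj : ∀ i j, i ≠ j → ¬ G.Adj i j → W i j = 0
  ker_eq : ∀ x : Fin n → ℝ, W *ᵥ x = 0 ↔ ∀ i j, x i = x j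

/-- The largest eigenvalue of `W`. -/
def lambdaMax {n : ℕ} (W : Matrix (Fin n) (Fin n) ℝ) : ℝ :=
  sSup (spectrum ℝ W)

/-- The smallest positive eigenvalue of `W`. -/
def lambdaMinPos {n : ℕ} (W : Matrix (Fin n) (Fin n) ℝ) : ℝ :=
  sInf {l | l ∈ spectrum ℝ W ∧ 0 < l}

/-- The action `W x` of a matrix on a vector of Euclidean space. -/
def mulVecE {n : ℕ} (W : Matrix (Fin n) (Fin n) ℝ) (x : EuclideanSpace ℝ (Fin n)) :
    EuclideanSpace ℝ (Fin n) :=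
  Matrix.toEuclideanCLM (𝕜 := ℝ) W x

/-- The operator norm of `W` with respect to the Euclidean norm (the spectral norm). -/
def spectralNorm2 {n : ℕ} (W : Matrix (Fin n) (Fin n) ℝ) : ℝ :=
  ‖Matrix.toEuclideanCLM (𝕜 := ℝ) W‖

/-- The consensus objective `r(x) = ‖√W x‖²`, with `√W` the positive semidefinite square root. -/
def consensusObj {n : ℕ} (W : Matrix (Fin n) (Fin n) ℝ) (x : EuclideanSpace ℝ (Fin n)) : ℝ :=
  ‖mulVecE (CFC.sqrt W) x‖ ^ 2

/-- The vector all of whose coordinates are the average of the coordinates of `x`. -/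
def averageVec {n : ℕ} (x : EuclideanSpace ℝ (Fin n)) : EuclideanSpace ℝ (Fin n) :=
  WithLp.toLp 2 fun _ => (1 / (n : ℝ)) * ∑ j, x j

/-! ### Markov chains -/

instance isMarkovKernel_pow {S : Type*} [MeasurableSpace S] (Q : Kernel S S) [IsMarkovKernel Q]
    (m : ℕ) : IsMarkovKernel (Q ^ m) := by
  induction m with
  | zero =>
    rw [pow_zero]
    exact inferInstanceAs (IsMarkovKernel (Kernel.id : Kernel S S))
  | succ m ih =>
    rw [pow_succ]
    exact inferInstanceAs (IsMarkovKernel ((Q ^ m) ∘ₖ Q))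

/-- `Δ(Q^m) = sup_{w, w'} (1/2) ‖Q^m(w, ·) - Q^m(w', ·)‖_TV`, where `‖·‖_TV` is the total variation
norm of a signed measure (the total mass of its total variation measure). -/
def dobrushinCoeff {S : Type*} [MeasurableSpace S] (Q : Kernel S S) [IsMarkovKernel Q] (m : ℕ) :
    ℝ≥0∞ :=
  ⨆ (w : S) (w' : S), (1 / 2 : ℝ≥0∞) *
    (((Q ^ m) w).toSignedMeasure - ((Q ^ m) w').toSignedMeasure).totalVariation Set.univ

/-- Uniform geometric ergodicity of `Q` with mixing time `τ`. -/
def IsUniformlyGeometricallyErgodic {S : Type*} [MeasurableSpace S] (Q : Kernel S S)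
    [IsMarkovKernel Q] (τ : ℕ) : Prop :=
  ∀ m : ℕ, dobrushinCoeff Q m ≤ (1 / 4 : ℝ≥0∞) ^ (m / τ)

/-- `X` is, under the probability `μ`, a stationary time-homogeneous Markov chain with Markov
kernel `Q` and unique invariant distribution `π`. -/
structure IsStationaryMarkovChain {Ω S : Type*} [MeasurableSpace Ω] [MeasurableSpace S]
    (X : ℕ → Ω → S) (Q : Kernel S S) (π : Measure S) (μ : Measure Ω) : Prop where
  measurable : ∀ k, Measurable (X k)
  isProbabilityMeasure : IsProbabilityMeasure π
  invariant : Kernel.Invariant Q π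
  unique : ∀ π' : Measure S, IsProbabilityMeasure π' → Kernel.Invariant Q π' → π' = π
  initial : HasLaw (X 0) π μ
  /-- Given `X 0, …, X k`, the conditional distribution of `X (k + 1)` is `Q (X k) ·`. -/
  markov : ∀ k : ℕ, HasCondDistrib (X (k + 1)) (fun ω (i : Fin (k + 1)) => X i ω)
    (Q.comap (fun h : Fin (k + 1) → S => h (Fin.last k)) (measurable_pi_apply _)) μ

/-! ### The algorithm -/

/-- The state after an iteration: the iterates `x` and `x_f` and the counter `T` of the
communication rounds already used. -/
structure AccState (n : ℕ) where
  x : EuclideanSpace ℝ (Fin n)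
  xf : EuclideanSpace ℝ (Fin n)
  T : ℕ

/-- The average `m⁻¹ ∑_{i=1}^{m} W_{T+i} y`. -/
def batchAverage {n : ℕ} (W : ℕ → Matrix (Fin n) (Fin n) ℝ) (T m : ℕ)
    (y : EuclideanSpace ℝ (Fin n)) : EuclideanSpace ℝ (Fin n) :=
  (m : ℝ)⁻¹ • ∑ i ∈ Finset.Icc 1 m, mulVecE (W (T + i)) y

/-- The multilevel Monte Carlo estimate `g = g_0 + 2^J (g_J - g_{J-1})` if `2^J ≤ M`, and `g = g_0`
otherwise, with `g_j = 2^{-j} B⁻¹ ∑_{i=1}^{2^j B} W_{T+i} y`. -/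
def mlmcEstimate {n : ℕ} (M : ℝ) (B : ℕ) (W : ℕ → Matrix (Fin n) (Fin n) ℝ) (T J : ℕ)
    (y : EuclideanSpace ℝ (Fin n)) : EuclideanSpace ℝ (Fin n) :=
  batchAverage W T B y +
    if (2 : ℝ) ^ J ≤ M then
      (2 : ℝ) ^ J • (batchAverage W T (2 ^ J * B) y - batchAverage W T (2 ^ (J - 1) * B) y)
    else 0

/-- One iteration, with the sampled level `J`. -/
def accStep {n : ℕ} (γ θ η β p M : ℝ) (B : ℕ) (W : ℕ → Matrix (Fin n) (Fin n) ℝ) (J : ℕ)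
    (s : AccState n) : AccState n :=
  let xg := θ • s.xf + (1 - θ) • s.x
  let g := mlmcEstimate M B W s.T J xg
  let xf' := xg - (p * γ) • g
  { x := η • xf' + (p - η) • s.xf + ((1 - p) * (1 - β)) • s.x + ((1 - p) * β) • xg
    xf := xf'
    T := s.T + 2 ^ J * B }

/-- The state after `k` iterations started from `x⁰ = x_f⁰`, `T⁰ = 0`, along the sequence of
matrices `W` and of sampled levels `J`. -/
def accIterate {n : ℕ} (γ θ η β p M : ℝ) (B : ℕ) (x₀ : EuclideanSpace ℝ (Fin n))
    (W : ℕ → Matrix (Fin n) (Fin n) ℝ) (J : ℕ → ℕ) : ℕ → AccState n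
  | 0 => ⟨x₀, x₀, 0⟩
  | k + 1 => accStep γ θ η β p M B W (J k) (accIterate γ θ η β p M B x₀ W J k)

end

/-!
Write `m` for the smallest positive eigenvalue of the mean matrix `Wt`, put `A = Wt / m`, and
measure the iterates from the average `xs`. Every gossip matrix kills `xs` and maps into the
subspace of vectors of zero coordinate sum. There `⟪v, A v⟫ ≥ ‖v‖²`, and the iterates stay there.
With `12 β² = m γ` and `d = x - y`, where `y` is the point `x_g`, one iteration reads

  `x⁺ = y + (1 - β) d - 3β (A y + ξ)`,  `x_f⁺ = y - 3β² (A y + ξ)`,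

where `x_f = y - ε d` for some `ε` close to `β / 4`, and `ξ` is the error of the multilevel
estimator (`accIterate_eq_centredIterate`).

*Deterministic part.* Consider the Lyapunov function
`V(x, x_f) = ‖x‖² + 2⟪x, x_f⟫ + 12⟪x_f, A x_f⟫`.
Its last term makes the first order parts of the products `⟪A y, d⟫` cancel. The cross term doubles
the decrease `-6β⟪y, A y⟫` that comes from `‖x‖²`. Without it, that decrease would not even pay for
the factor `1 - β / 2`. With it, `V` contracts by `1 - β / 2` and a multiple of `β‖y‖²` is left over
to absorb the effect of `ξ` (`lyapunov_step_le`). On vectors of zero sum `V` is comparable to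
`‖x‖² + 24⟪x_f, A x_f⟫`, the quantity in the theorem.

*Stochastic part.* The error `ξ` enters `V` through a product `⟪l, ξ⟫` with a vector `l` known
before the iteration and through `‖ξ‖²` (`lyapunov_sub_smul_le`). The matrices used in the iteration
come after those used before. By the mixing of the chain, a batch average of `N` of them has a bias
of order `τ / N` relative to the past and a variance of order `τ / N`. In expectation over the level,
the multilevel corrections telescope. The bias is therefore that of a batch of size `2 ^ K * B`, with
`2 ^ K` of order `M`, while the second moment is only `O(K)` times that of a batch of size `B`
(`IsCenteredNoise.levelMean_integral_inner_le`, `IsCenteredNoise.levelMean_integral_norm_sq_le`).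
The choice of `M` and `B` and the bound on `γ` make both small enough (`multilevel_constants_le`).

*Independence.* The starting time of each batch depends on the earlier levels, so the estimates are
made for the chain with all levels fixed. By independence the chain can be integrated out first
(`integral_path_levels_eq`), and then the levels one after the other
(`integral_eq_integral_levelMean`). Induction on the number of iterations yields
`E V ≤ (1 - β / 2) ^ N V₀` (`IsCenteredNoise.integral_lyapunov_centredIterate_le`).
-/

/-! ### The Lyapunov function -/

section Deterministic

open scoped RealInnerProductSpace

variable {E : Type*} [NormedAddCommGroup E] [InnerProductSpace ℝ E]

/-- The Lyapunov function of the pair of iterates `x`, `xf`, both measured from the minimizer, for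
the quadratic form of `A`. The cross term yields the decrease in the direction of the point at which
the gradient is evaluated. -/
def lyapunov (A : E →L[ℝ] E) (x xf : E) : ℝ :=
  ‖x‖ ^ 2 + 2 * ⟪x, xf⟫ + 12 * ⟪xf, A xf⟫

/-- The vector paired with the gradient error `ξ` in the Lyapunov function at
`(u - 3β ξ, v - 3β² ξ)`. -/
def errorDirection (A : E →L[ℝ] E) (β : ℝ) (u v : E) : E :=
  (6 * β + 6 * β ^ 2) • u + (6 * β) • v + (72 * β ^ 2) • A v

/-- A gradient error `ξ` changes the Lyapunov function by a term linear in `ξ` and one bounded by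
`‖ξ‖²`. The first is controlled by the bias of the estimator and the second by its variance. -/
theorem lyapunov_sub_smul_le {A : E →L[ℝ] E} (hA : ∀ v w, ⟪A v, w⟫ = ⟪v, A w⟫) {β : ℝ}
    (hβ0 : 0 ≤ β) (hβ : β ≤ 1 / 4) (hAβ : ∀ v, 16 * β ^ 2 * ⟪v, A v⟫ ≤ ‖v‖ ^ 2) (u v ξ : E) :
    lyapunov A (u - (3 * β) • ξ) (v - (3 * β ^ 2) • ξ) ≤
      lyapunov A u v - ⟪errorDirection A β u v, ξ⟫ + 81 / 4 * β ^ 2 * ‖ξ‖ ^ 2 := by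
  have h1 := hAβ ξ
  have e1 : ⟪ξ, A v⟫ = ⟪A v, ξ⟫ := real_inner_comm _ _
  have e2 : ⟪v, A ξ⟫ = ⟪A v, ξ⟫ := (hA v ξ).symm
  have e3 : ⟪ξ, u⟫ = ⟪u, ξ⟫ := real_inner_comm _ _
  have e4 : ⟪ξ, v⟫ = ⟪v, ξ⟫ := real_inner_comm _ _
  unfold lyapunov errorDirection
  rw [norm_sub_sq_real, norm_smul, Real.norm_eq_abs, abs_of_nonneg (by positivity : 0 ≤ 3 * β)]
  simp only [map_sub, map_smul, inner_sub_left, inner_sub_right, inner_add_left,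
    real_inner_smul_left, real_inner_smul_right, e1, e2, e4, real_inner_self_eq_norm_sq]
  have h2 : β ^ 2 * (16 * β ^ 2 * ⟪ξ, A ξ⟫) ≤ β ^ 2 * ‖ξ‖ ^ 2 := by gcongr
  have h3 : β * (β ^ 2 * ‖ξ‖ ^ 2) ≤ 1 / 4 * (β ^ 2 * ‖ξ‖ ^ 2) := by gcongr
  nlinarith [h2, h3]

theorem norm_errorDirection_le {A : E →L[ℝ] E} {β : ℝ} (hβ0 : 0 ≤ β) (hβ : β ≤ 1 / 4)
    (hAn : ∀ v, 16 * β ^ 2 * ‖A v‖ ≤ ‖v‖) (y d : E) :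
    ‖errorDirection A β (y + (1 - β) • d - (3 * β) • A y) (y - (3 * β ^ 2) • A y)‖ ≤
      27 / 2 * β * ‖y‖ + 15 / 2 * β * ‖d‖ + 135 / 2 * β ^ 2 * ‖A y‖ := by
  have e : errorDirection A β (y + (1 - β) • d - (3 * β) • A y) (y - (3 * β ^ 2) • A y) =
      (12 * β + 6 * β ^ 2) • y + ((6 * β + 6 * β ^ 2) * (1 - β)) • d +
        (54 * β ^ 2 - 36 * β ^ 3) • A y - (216 * β ^ 4) • A (A y) := by
    unfold errorDirection
    simp only [map_sub, map_smul]
    module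
  have h0 := hAn (A y)
  have h1 : 0 ≤ 54 * β ^ 2 - 36 * β ^ 3 := by nlinarith [sq_nonneg β]
  rw [e]
  refine (norm_sub_le _ _).trans ?_
  refine (add_le_add_left (norm_add₃_le) _).trans ?_
  simp only [norm_smul, Real.norm_eq_abs]
  rw [abs_of_nonneg (by positivity), abs_of_nonneg (mul_nonneg (by positivity) (by linarith)),
    abs_of_nonneg h1, abs_of_nonneg (by positivity)]
  have k1 : (12 * β + 6 * β ^ 2) * ‖y‖ ≤ 27 / 2 * β * ‖y‖ := by
    gcongr; nlinarith
  have k2 : (6 * β + 6 * β ^ 2) * (1 - β) * ‖d‖ ≤ 15 / 2 * β * ‖d‖ := by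
    refine mul_le_mul_of_nonneg_right ?_ (norm_nonneg _); nlinarith [pow_nonneg hβ0 3]
  have k3 : (54 * β ^ 2 - 36 * β ^ 3) * ‖A y‖ ≤ 54 * β ^ 2 * ‖A y‖ := by
    gcongr; nlinarith [pow_nonneg hβ0 3]
  have k4 : 216 * β ^ 4 * ‖A (A y)‖ ≤ 27 / 2 * β ^ 2 * ‖A y‖ := by
    have := mul_le_mul_of_nonneg_left h0 (by positivity : 0 ≤ 27 / 2 * β ^ 2)
    nlinarith
  linarith

/-- The coefficients of `‖d‖²`, `⟪y, d⟫` and `⟪A y, d⟫` in the decrease of the Lyapunov function. In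
the last one the terms of first order in `β` cancel, since `24 ε = 6 β + O(β²)`. -/
theorem stepCoeff_bounds {β ε : ℝ} (hβ0 : 0 ≤ β) (hβ : β ≤ 1 / 4)
    (hε : ε * (4 - β) = β * (1 - β)) :
    β * (7 / 8) ≤ (1 - β / 2) * (1 - 2 * ε) - (1 - β) ^ 2 ∧
      |2 * β - 2 * (ε * (1 - β / 2))| ≤ 2 * β ∧
      |6 * β * (1 - β) + 6 * β ^ 2 * (1 - β) - 24 * (ε * (1 - β / 2))| ≤ 38 / 5 * β ^ 2 := by
  have hε0 : 0 ≤ ε := by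
    refine nonneg_of_mul_nonneg_left (b := 4 - β) ?_ (by linarith)
    rw [hε]; exact mul_nonneg hβ0 (by linarith)
  have hε1 : ε * (1 - β / 2) ≤ β * (1 - β) / 4 := by
    linarith [mul_nonneg hε0 hβ0]
  have hε2 : 0 ≤ ε * (1 - β / 2) := mul_nonneg hε0 (by linarith)
  have hk : ε * (1 - β / 2) * (4 - β) = β * (1 - β) * (1 - β / 2) := by rw [← hε]; ring
  set f := ε * (1 - β / 2) with hf
  refine ⟨by linarith [sq_nonneg β, mul_nonneg hβ0 (sub_nonneg.2 hβ)], ?_, ?_⟩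
  · have : 0 ≤ β * (1 - β) := mul_nonneg hβ0 (by linarith)
    rw [abs_le]; constructor <;> linarith [sq_nonneg β]
  · set ck := 6 * β * (1 - β) + 6 * β ^ 2 * (1 - β) - 24 * f with hck
    have k1 : ck * (4 - β) = 6 * β ^ 2 * (1 - β) * (5 - β) := by
      rw [hck]; linear_combination -24 * hk
    have k2 : 0 ≤ ck := by
      refine nonneg_of_mul_nonneg_left (b := 4 - β) ?_ (by linarith)
      rw [k1]
      exact mul_nonneg (mul_nonneg (by positivity) (by linarith)) (by linarith)
    rw [abs_of_nonneg k2]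
    refine le_of_mul_le_mul_right (a := 4 - β) ?_ (by linarith)
    rw [k1]
    have : 0 ≤ β ^ 2 * (β * (28 - 6 * β)) := mul_nonneg (sq_nonneg β) (mul_nonneg hβ0 (by linarith))
    linarith [mul_nonneg hβ0 (sq_nonneg β), mul_nonneg (sq_nonneg β) (sq_nonneg β), sq_nonneg β]

/-- A lower bound for the decrease that remains after the bias and the variance have been paid for,
as a quadratic form in `Y = ‖y‖`, `D = ‖d‖` and `N = ‖A y‖`. -/
theorem stepForm_nonneg {β Y D N : ℝ} (hβ0 : 0 ≤ β) (hβ : β ≤ 1 / 4) :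
    0 ≤ β * (4.5 * Y ^ 2 + 7 / 8 * D ^ 2 - 2 * (Y * D) - 27 / 80 * Y ^ 2
      - 1 / 10 * (27 / 2 * Y ^ 2 + 15 / 2 * (Y * D)))
      + β ^ 2 * (51.75 * N ^ 2 - 38 / 5 * (N * D) - 6.75 * (N * Y)) := by
  -- the minimum over `N`; the factor `4` is offset by one factor `β ≤ 1 / 4`
  have k1 : -(0.1396 * D ^ 2 + 0.111 * Y ^ 2) * 4 ≤
      51.75 * N ^ 2 - 38 / 5 * (N * D) - 6.75 * (N * Y) := by
    linarith [sq_nonneg (103.5 * N - (38 / 5 * D + 6.75 * Y)),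
      sq_nonneg (38 / 5 * D - 6.75 * Y), sq_nonneg D, sq_nonneg Y]
  have k2 : 0 ≤ 2.8125 * Y ^ 2 + 7 / 8 * D ^ 2 - 2.75 * (Y * D)
      - (0.1396 * D ^ 2 + 0.111 * Y ^ 2) := by
    linarith [sq_nonneg (2.7 * Y - 1.375 * D), sq_nonneg Y, sq_nonneg D]
  have k3 : -(0.1396 * D ^ 2 + 0.111 * Y ^ 2) * β ≤
      β ^ 2 * (51.75 * N ^ 2 - 38 / 5 * (N * D) - 6.75 * (N * Y)) := by
    refine le_trans ?_ (mul_le_mul_of_nonneg_left k1 (sq_nonneg β))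
    have : 0 ≤ (0.1396 * D ^ 2 + 0.111 * Y ^ 2) * β * (1 - 4 * β) :=
      mul_nonneg (by positivity) (by linarith)
    linarith
  linarith [mul_nonneg hβ0 k2]

/-- The contraction in terms of the inner products of `y` and `d`: here `h = ⟪y, d⟫`,
`h1 = ⟪A y, d⟫`, `a1 = ⟪y, A y⟫`, `q1 = ⟪d, A d⟫` and `m3 = ⟪A y, A (A y)⟫`, while `l` is the norm
of the vector paired with the gradient error. -/
theorem lyapunov_step_scalar {β ε Y D N a1 h h1 q1 m3 l : ℝ} (hβ0 : 0 ≤ β) (hβ : β ≤ 1 / 4)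
    (hε : ε * (4 - β) = β * (1 - β)) (hY0 : 0 ≤ Y) (_ : 0 ≤ D) (_ : 0 ≤ N)
    (hy : Y ^ 2 ≤ a1) (hd0 : 0 ≤ q1) (h3 : 16 * β ^ 2 * m3 ≤ N ^ 2)
    (hyd : |h| ≤ Y * D) (hyd1 : |h1| ≤ N * D)
    (hl : l ≤ 27 / 2 * β * Y + 15 / 2 * β * D + 135 / 2 * β ^ 2 * N) :
    Y ^ 2 + 2 * (1 - β) * h + (1 - β) ^ 2 * D ^ 2
        - 6 * β * (a1 + (1 - β) * h1) + 9 * β ^ 2 * N ^ 2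
      + 2 * (Y ^ 2 + (1 - β) * h - 3 * β * a1
        - 3 * β ^ 2 * (a1 + (1 - β) * h1) + 9 * β ^ 3 * N ^ 2)
      + 12 * (a1 - 6 * β ^ 2 * N ^ 2 + 9 * β ^ 4 * m3)
      + 1 / 10 * (l * Y) + 27 / 80 * β * Y ^ 2 ≤
    (1 - β / 2) * (Y ^ 2 + 2 * h + D ^ 2 + 2 * (Y ^ 2 + (1 - ε) * h - ε * D ^ 2) +
      12 * (a1 - 2 * ε * h1 + ε ^ 2 * q1)) := by
  have hl2 := mul_le_mul_of_nonneg_right hl hY0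
  have h3' : β ^ 2 * (16 * β ^ 2 * m3) ≤ β ^ 2 * N ^ 2 := by gcongr
  obtain ⟨c1, c2, c3⟩ := stepCoeff_bounds hβ0 hβ hε
  have key := stepForm_nonneg (Y := Y) (D := D) (N := N) hβ0 hβ
  have c1' := mul_le_mul_of_nonneg_right c1 (sq_nonneg D)
  have c2' : -(2 * β * (Y * D)) ≤ (2 * β - 2 * (ε * (1 - β / 2))) * h := by
    have := abs_mul (2 * β - 2 * (ε * (1 - β / 2))) h ▸
      mul_le_mul c2 hyd (abs_nonneg _) (by positivity)
    exact (abs_le.1 this).1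
  have c3' : -(38 / 5 * β ^ 2 * (N * D)) ≤
      (6 * β * (1 - β) + 6 * β ^ 2 * (1 - β) - 24 * (ε * (1 - β / 2))) * h1 := by
    have := abs_mul (6 * β * (1 - β) + 6 * β ^ 2 * (1 - β) - 24 * (ε * (1 - β / 2))) h1 ▸
      mul_le_mul c3 hyd1 (abs_nonneg _) (by positivity)
    exact (abs_le.1 this).1
  have c4 : 0 ≤ (1 - β / 2) * (12 * (ε ^ 2 * q1)) :=
    mul_nonneg (by linarith) (by positivity)
  have c5 : 6 * β * Y ^ 2 ≤ (6 * β + 6 * β ^ 2) * a1 := by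
    linarith [mul_nonneg hβ0 (sub_nonneg.2 hy), mul_nonneg (sq_nonneg β) (sub_nonneg.2 hy),
      mul_nonneg (sq_nonneg β) (sq_nonneg Y)]
  have c6 : 18 * β ^ 3 * N ^ 2 ≤ 18 / 4 * (β ^ 2 * N ^ 2) := by
    linarith [mul_nonneg (sub_nonneg.2 hβ) (mul_nonneg (sq_nonneg β) (sq_nonneg N))]
  linarith [key, c1', c2', c3', c4, c5, c6, h3', hl2]

/-- The exact gradient step from `x = y + d`, `x_f = y - ε d` contracts the Lyapunov function by
`1 - β / 2`, with room for a bias of relative size `1 / 10` and for the variance. -/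
theorem lyapunov_step_le {A : E →L[ℝ] E} (hA : ∀ v w, ⟪A v, w⟫ = ⟪v, A w⟫) {β ε : ℝ}
    (hβ0 : 0 ≤ β) (hβ : β ≤ 1 / 4) (hA0 : ∀ v, 0 ≤ ⟪v, A v⟫)
    (hAβ : ∀ v, 16 * β ^ 2 * ⟪v, A v⟫ ≤ ‖v‖ ^ 2) (hAn : ∀ v, 16 * β ^ 2 * ‖A v‖ ≤ ‖v‖)
    (hε : ε * (4 - β) = β * (1 - β)) (y d : E) (hy : ‖y‖ ^ 2 ≤ ⟪y, A y⟫) :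
    lyapunov A (y + (1 - β) • d - (3 * β) • A y) (y - (3 * β ^ 2) • A y) +
        1 / 10 * (‖errorDirection A β (y + (1 - β) • d - (3 * β) • A y)
          (y - (3 * β ^ 2) • A y)‖ * ‖y‖) + 27 / 80 * β * ‖y‖ ^ 2 ≤
      (1 - β / 2) * lyapunov A (y + d) (y - ε • d) := by
  have hl := norm_errorDirection_le hβ0 hβ hAn y d
  have h3 := hAβ (A y)
  have hd0 := hA0 d
  have hyd := abs_real_inner_le_norm y d
  have hyd1 := abs_real_inner_le_norm (A y) d
  set Y := ‖y‖ with hY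
  set D := ‖d‖ with hD
  set N := ‖A y‖ with hN
  have hY0 : 0 ≤ Y := norm_nonneg _
  have hD0 : 0 ≤ D := norm_nonneg _
  have hN0 : 0 ≤ N := norm_nonneg _
  have e1 : ⟪A y, y⟫ = ⟪y, A y⟫ := real_inner_comm _ _
  have e2 : ⟪d, y⟫ = ⟪y, d⟫ := real_inner_comm _ _
  have e3 : ⟪d, A y⟫ = ⟪A y, d⟫ := real_inner_comm _ _
  have e4 : ⟪y, A d⟫ = ⟪A y, d⟫ := (hA y d).symm
  have e5 : ⟪y, A (A y)⟫ = N ^ 2 := by rw [← hA, real_inner_self_eq_norm_sq]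
  have E1 : lyapunov A (y + d) (y - ε • d) =
      Y ^ 2 + 2 * ⟪y, d⟫ + D ^ 2 + 2 * (Y ^ 2 + (1 - ε) * ⟪y, d⟫ - ε * D ^ 2) +
      12 * (⟪y, A y⟫ - 2 * ε * ⟪A y, d⟫ + ε ^ 2 * ⟪d, A d⟫) := by
    unfold lyapunov
    rw [norm_add_sq_real]
    simp only [map_sub, map_smul, inner_sub_left, inner_sub_right, inner_add_left,
      real_inner_smul_left, real_inner_smul_right, e2, e3, e4, real_inner_self_eq_norm_sq]
    ring
  have E2 : lyapunov A (y + (1 - β) • d - (3 * β) • A y) (y - (3 * β ^ 2) • A y) =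
      Y ^ 2 + 2 * (1 - β) * ⟪y, d⟫ + (1 - β) ^ 2 * D ^ 2
        - 6 * β * (⟪y, A y⟫ + (1 - β) * ⟪A y, d⟫) + 9 * β ^ 2 * N ^ 2
      + 2 * (Y ^ 2 + (1 - β) * ⟪y, d⟫ - 3 * β * ⟪y, A y⟫
        - 3 * β ^ 2 * (⟪y, A y⟫ + (1 - β) * ⟪A y, d⟫) + 9 * β ^ 3 * N ^ 2)
      + 12 * (⟪y, A y⟫ - 6 * β ^ 2 * N ^ 2 + 9 * β ^ 4 * ⟪A y, A (A y)⟫) := by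
    unfold lyapunov
    rw [← real_inner_self_eq_norm_sq]
    simp only [map_sub, map_smul, inner_sub_left, inner_sub_right, inner_add_left, inner_add_right,
      real_inner_smul_left, real_inner_smul_right, e1, e2, e3, e5, real_inner_self_eq_norm_sq,
      norm_smul, mul_pow, Real.norm_eq_abs, sq_abs]
    ring
  rw [E1, E2]
  exact lyapunov_step_scalar hβ0 hβ hε hY0 hD0 hN0 hy hd0 h3 hyd hyd1 hl

theorem half_norm_sq_add_le_lyapunov {A : E →L[ℝ] E} (x xf : E) (hxf : ‖xf‖ ^ 2 ≤ ⟪xf, A xf⟫) :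
    1 / 2 * ‖x‖ ^ 2 + 10 * ⟪xf, A xf⟫ ≤ lyapunov A x xf := by
  have := abs_le.1 (abs_real_inner_le_norm x xf)
  unfold lyapunov
  nlinarith [sq_nonneg (‖x‖ - 2 * ‖xf‖)]

theorem lyapunov_self_le {A : E →L[ℝ] E} (x : E) (hx : ‖x‖ ^ 2 ≤ ⟪x, A x⟫) :
    lyapunov A x x ≤ 2 * ‖x‖ ^ 2 + 13 * ⟪x, A x⟫ := by
  unfold lyapunov
  rw [real_inner_self_eq_norm_sq]
  linarith

end Deterministic

/-! ### Spectral bounds for gossip matrices -/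

section Spectral

open scoped RealInnerProductSpace

variable {n : ℕ} {W : Matrix (Fin n) (Fin n) ℝ}

theorem Matrix.IsHermitian.inner_toEuclideanCLM_comm (hW : W.IsHermitian)
    (x y : EuclideanSpace ℝ (Fin n)) :
    ⟪Matrix.toEuclideanCLM (𝕜 := ℝ) W x, y⟫ = ⟪x, Matrix.toEuclideanCLM (𝕜 := ℝ) W y⟫ := by
  have h : (Matrix.toEuclideanCLM (𝕜 := ℝ) W).adjoint = Matrix.toEuclideanCLM (𝕜 := ℝ) W := by
    rw [← ContinuousLinearMap.star_eq_adjoint, ← map_star]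
    congr 1
  rw [← ContinuousLinearMap.adjoint_inner_right, h]

theorem Matrix.IsHermitian.toEuclideanCLM_eigenvectorBasis (hW : W.IsHermitian) (i : Fin n) :
    Matrix.toEuclideanCLM (𝕜 := ℝ) W (hW.eigenvectorBasis i) =
      hW.eigenvalues i • hW.eigenvectorBasis i := by
  apply (WithLp.ofLp_injective 2)
  rw [Matrix.ofLp_toEuclideanCLM, hW.mulVec_eigenvectorBasis]
  rfl

theorem Matrix.IsHermitian.inner_eigenvectorBasis_toEuclideanCLM (hW : W.IsHermitian) (i : Fin n)
    (x : EuclideanSpace ℝ (Fin n)) :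
    ⟪hW.eigenvectorBasis i, Matrix.toEuclideanCLM (𝕜 := ℝ) W x⟫ =
      hW.eigenvalues i * ⟪hW.eigenvectorBasis i, x⟫ := by
  rw [← hW.inner_toEuclideanCLM_comm, hW.toEuclideanCLM_eigenvectorBasis, real_inner_smul_left]

theorem Matrix.IsHermitian.inner_toEuclideanCLM_eq_sum (hW : W.IsHermitian)
    (x : EuclideanSpace ℝ (Fin n)) :
    ⟪x, Matrix.toEuclideanCLM (𝕜 := ℝ) W x⟫ =
      ∑ i, hW.eigenvalues i * ⟪hW.eigenvectorBasis i, x⟫ ^ 2 := by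
  rw [← hW.eigenvectorBasis.sum_inner_mul_inner]
  refine Finset.sum_congr rfl fun i _ => ?_
  rw [hW.inner_eigenvectorBasis_toEuclideanCLM, real_inner_comm x]
  ring

theorem OrthonormalBasis.norm_sq_eq_sum_inner_sq {ι E : Type*} [Fintype ι] [NormedAddCommGroup E]
    [InnerProductSpace ℝ E] (b : OrthonormalBasis ι ℝ E) (x : E) :
    ‖x‖ ^ 2 = ∑ i, ⟪b i, x⟫ ^ 2 := by
  rw [← real_inner_self_eq_norm_sq, ← b.sum_inner_mul_inner]
  refine Finset.sum_congr rfl fun i _ => ?_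
  rw [real_inner_comm x]
  ring

theorem Matrix.PosSemidef.eigenvalues_le_lambdaMax (hW : W.PosSemidef) (i : Fin n) :
    hW.1.eigenvalues i ≤ lambdaMax W :=
  le_csSup (Matrix.finite_real_spectrum).bddAbove (hW.1.eigenvalues_mem_spectrum_real i)

theorem Matrix.PosSemidef.inner_toEuclideanCLM_nonneg (hW : W.PosSemidef)
    (x : EuclideanSpace ℝ (Fin n)) : 0 ≤ ⟪x, Matrix.toEuclideanCLM (𝕜 := ℝ) W x⟫ := by
  rw [hW.1.inner_toEuclideanCLM_eq_sum]
  exact Finset.sum_nonneg fun i _ => mul_nonneg (hW.eigenvalues_nonneg i) (sq_nonneg _)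

theorem Matrix.PosSemidef.inner_toEuclideanCLM_le (hW : W.PosSemidef)
    (x : EuclideanSpace ℝ (Fin n)) :
    ⟪x, Matrix.toEuclideanCLM (𝕜 := ℝ) W x⟫ ≤ lambdaMax W * ‖x‖ ^ 2 := by
  rw [hW.1.inner_toEuclideanCLM_eq_sum, hW.1.eigenvectorBasis.norm_sq_eq_sum_inner_sq,
    Finset.mul_sum]
  exact Finset.sum_le_sum fun i _ =>
    mul_le_mul_of_nonneg_right (hW.eigenvalues_le_lambdaMax i) (sq_nonneg _)

theorem Matrix.PosSemidef.norm_toEuclideanCLM_le (hW : W.PosSemidef) (hmax : 0 ≤ lambdaMax W)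
    (x : EuclideanSpace ℝ (Fin n)) :
    ‖Matrix.toEuclideanCLM (𝕜 := ℝ) W x‖ ≤ lambdaMax W * ‖x‖ := by
  refine le_of_sq_le_sq ?_ (by positivity)
  rw [mul_pow, hW.1.eigenvectorBasis.norm_sq_eq_sum_inner_sq x,
    hW.1.eigenvectorBasis.norm_sq_eq_sum_inner_sq, Finset.mul_sum]
  refine Finset.sum_le_sum fun i _ => ?_
  rw [hW.1.inner_eigenvectorBasis_toEuclideanCLM, mul_pow]
  have := hW.eigenvalues_le_lambdaMax i
  have := hW.eigenvalues_nonneg i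
  gcongr

section Gossip

variable {G : SimpleGraph (Fin n)}

/-- The infimum is attained: a gossip matrix on at least two nodes is not zero, so it has a positive
eigenvalue. -/
theorem Matrix.PosSemidef.lambdaMinPos_mem (hn : 2 ≤ n) (hW : W.PosSemidef)
    (hG : IsGossipMatrix G W) :
    lambdaMinPos W ∈ {l | l ∈ spectrum ℝ W ∧ 0 < l} := by
  refine Set.Nonempty.csInf_mem ?_ (Matrix.finite_real_spectrum.subset fun _ h => h.1)
  by_contra hne
  have h0 : ∀ i, hW.1.eigenvalues i = 0 := fun i => by
    by_contra hi
    exact hne ⟨_, hW.1.eigenvalues_mem_spectrum_real i,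
      lt_of_le_of_ne (hW.eigenvalues_nonneg i) (Ne.symm hi)⟩
  have h1 : W = 0 := hW.1.eigenvalues_eq_zero_iff.1 (funext h0)
  have := (hG.ker_eq (Pi.single ⟨0, by omega⟩ 1)).1
    (by rw [h1, Matrix.zero_mulVec]) ⟨0, by omega⟩ ⟨1, by omega⟩
  simp at this

theorem Matrix.PosSemidef.lambdaMinPos_pos (hn : 2 ≤ n) (hW : W.PosSemidef)
    (hG : IsGossipMatrix G W) : 0 < lambdaMinPos W :=
  (hW.lambdaMinPos_mem hn hG).2

theorem Matrix.PosSemidef.lambdaMinPos_le_lambdaMax (hn : 2 ≤ n) (hW : W.PosSemidef)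
    (hG : IsGossipMatrix G W) : lambdaMinPos W ≤ lambdaMax W :=
  le_csSup (Matrix.finite_real_spectrum).bddAbove (hW.lambdaMinPos_mem hn hG).1

/-- The kernel of a gossip matrix consists of the constant vectors, so on vectors of zero
coordinate sum the quadratic form is bounded below by the smallest positive eigenvalue. -/
theorem Matrix.PosSemidef.lambdaMinPos_mul_le (hW : W.PosSemidef)
    (hG : IsGossipMatrix G W) {x : EuclideanSpace ℝ (Fin n)} (hx : ∑ i, x i = 0) :
    lambdaMinPos W * ‖x‖ ^ 2 ≤ ⟪x, Matrix.toEuclideanCLM (𝕜 := ℝ) W x⟫ := by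
  rw [hW.1.inner_toEuclideanCLM_eq_sum, hW.1.eigenvectorBasis.norm_sq_eq_sum_inner_sq,
    Finset.mul_sum]
  refine Finset.sum_le_sum fun i _ => ?_
  rcases (hW.eigenvalues_nonneg i).eq_or_lt with h0 | hpos
  · have h1 := hW.1.mulVec_eigenvectorBasis i
    rw [← h0, zero_smul] at h1
    have h2 := (hG.ker_eq _).1 h1
    have h3 : ⟪hW.1.eigenvectorBasis i, x⟫ = 0 := by
      rw [PiLp.inner_apply]
      simp only [RCLike.inner_apply, conj_trivial]
      calc ∑ j, x j * hW.1.eigenvectorBasis i j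
          = ∑ j, x j * hW.1.eigenvectorBasis i i :=
            Finset.sum_congr rfl fun j _ => by rw [h2 j i]
        _ = 0 := by rw [← Finset.sum_mul, hx, zero_mul]
    simp [h3]
  · refine mul_le_mul_of_nonneg_right ?_ (sq_nonneg _)
    exact csInf_le ⟨0, fun l hl => hl.2.le⟩ ⟨hW.1.eigenvalues_mem_spectrum_real i, hpos⟩

end Gossip

theorem Matrix.PosSemidef.consensusObj_eq (hW : W.PosSemidef) (x : EuclideanSpace ℝ (Fin n)) :
    consensusObj W x = ⟪x, Matrix.toEuclideanCLM (𝕜 := ℝ) W x⟫ := by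
  have h1 : (CFC.sqrt W).IsHermitian := (Matrix.nonneg_iff_posSemidef.1 (CFC.sqrt_nonneg W)).1
  rw [consensusObj, mulVecE, ← real_inner_self_eq_norm_sq, h1.inner_toEuclideanCLM_comm]
  congr 1
  rw [← mul_apply_eq_comp, ← map_mul, CFC.sqrt_mul_sqrt_self W hW.nonneg]

theorem sum_averageVec {n : ℕ} (hn : n ≠ 0) (x : EuclideanSpace ℝ (Fin n)) :
    ∑ i, averageVec x i = ∑ i, x i := by
  have : (n : ℝ) ≠ 0 := by exact_mod_cast hn
  simp [averageVec, mul_inv_cancel_left₀ this]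

theorem IsGossipMatrix.mulVecE_averageVec {G : SimpleGraph (Fin n)} (hG : IsGossipMatrix G W)
    (x : EuclideanSpace ℝ (Fin n)) : mulVecE W (averageVec x) = 0 := by
  apply (WithLp.ofLp_injective 2)
  rw [mulVecE, Matrix.ofLp_toEuclideanCLM]
  exact (hG.ker_eq _).2 fun i j => rfl

/-- A matrix with vanishing column sums maps into the vectors of zero coordinate sum. -/
theorem sum_mulVecE_eq_zero (h : (fun _ => (1 : ℝ)) ᵥ* W = 0) (x : EuclideanSpace ℝ (Fin n)) :
    ∑ i, mulVecE W x i = 0 := by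
  have : (fun _ => (1 : ℝ)) ⬝ᵥ (W *ᵥ x) = 0 := by
    rw [Matrix.dotProduct_mulVec, h, zero_dotProduct]
  simpa [dotProduct, mulVecE, Matrix.ofLp_toEuclideanCLM] using this

end Spectral

/-! ### Mixing of the chain -/

section Mixing

variable {S : Type*} [MeasurableSpace S]

theorem integrable_of_measurable_of_abs_le {α : Type*} [MeasurableSpace α] {m : Measure α}
    [IsFiniteMeasure m] {f : α → ℝ} (hf : Measurable f) {C : ℝ} (hC : ∀ a, |f a| ≤ C) :
    Integrable f m :=
  Integrable.of_bound hf.aestronglyMeasurable C (ae_of_all _ hC)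

theorem abs_integral_le_of_abs_le {m : Measure S} [IsProbabilityMeasure m] {f : S → ℝ} {C : ℝ}
    (hC : ∀ s, |f s| ≤ C) : |∫ s, f s ∂m| ≤ C := by
  have := norm_integral_le_of_norm_le_const (μ := m) (f := f) (ae_of_all _ hC)
  simpa using this

/-- A bounded function has integrals against two finite measures that differ by at most its bound
times the total variation norm of the difference. -/
theorem abs_integral_sub_integral_le_totalVariation {m m' : Measure S} [IsFiniteMeasure m]
    [IsFiniteMeasure m'] {f : S → ℝ} (hf : Measurable f) {C : ℝ} (hC : ∀ s, |f s| ≤ C) :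
    |∫ s, f s ∂m - ∫ s, f s ∂m'| ≤
      C * ((m.toSignedMeasure - m'.toSignedMeasure).totalVariation Set.univ).toReal := by
  set j := (m.toSignedMeasure - m'.toSignedMeasure).toJordanDecomposition with hj
  have h1 : j.posPart.toSignedMeasure - j.negPart.toSignedMeasure =
      m.toSignedMeasure - m'.toSignedMeasure :=
    SignedMeasure.toSignedMeasure_toJordanDecomposition _
  have h2 : m + j.negPart = m' + j.posPart := by
    rw [← Measure.toSignedMeasure_eq_toSignedMeasure_iff, Measure.toSignedMeasure_add,
      Measure.toSignedMeasure_add]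
    rw [sub_eq_sub_iff_add_eq_add] at h1
    rw [add_comm m'.toSignedMeasure, h1]
  have hi : ∀ (k : Measure S) [IsFiniteMeasure k], Integrable f k := fun k _ =>
    integrable_of_measurable_of_abs_le hf hC
  have h3 : ∫ s, f s ∂m + ∫ s, f s ∂j.negPart = ∫ s, f s ∂m' + ∫ s, f s ∂j.posPart := by
    rw [← integral_add_measure (hi _) (hi _), ← integral_add_measure (hi _) (hi _), h2]
  have hb : ∀ (k : Measure S) [IsFiniteMeasure k], |∫ s, f s ∂k| ≤ C * (k Set.univ).toReal :=
    fun k _ => norm_integral_le_of_norm_le_const (μ := k) (f := f) (ae_of_all _ hC)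
  have h4 : ∫ s, f s ∂m - ∫ s, f s ∂m' = ∫ s, f s ∂j.posPart - ∫ s, f s ∂j.negPart := by linarith
  rw [h4, SignedMeasure.totalVariation, ← hj, Measure.add_apply, ENNReal.toReal_add
    (measure_ne_top _ _) (measure_ne_top _ _), mul_add]
  exact (abs_sub _ _).trans (add_le_add (hb _) (hb _))

variable {Q : Kernel S S} {π : Measure S} {τ : ℕ}

theorem ProbabilityTheory.Kernel.Invariant.pow (h : Kernel.Invariant Q π) (m : ℕ) :
    Kernel.Invariant (Q ^ m) π := by
  induction m with
  | zero => rw [pow_zero]; exact Measure.id_comp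
  | succ m ih => rw [pow_succ]; exact ih.comp h

variable [IsMarkovKernel Q]

theorem IsUniformlyGeometricallyErgodic.totalVariation_le
    (h : IsUniformlyGeometricallyErgodic Q τ) (m : ℕ) (w w' : S) :
    ((((Q ^ m) w).toSignedMeasure - ((Q ^ m) w').toSignedMeasure).totalVariation
      Set.univ).toReal ≤ 2 * (1 / 4) ^ (m / τ) := by
  set T := (((Q ^ m) w).toSignedMeasure - ((Q ^ m) w').toSignedMeasure).totalVariation Set.univ
  have h1 : (1 / 2 : ℝ≥0∞) * T ≤ (1 / 4) ^ (m / τ) :=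
    (le_iSup₂ (f := fun (w : S) (w' : S) => (1 / 2 : ℝ≥0∞) *
      (((Q ^ m) w).toSignedMeasure - ((Q ^ m) w').toSignedMeasure).totalVariation Set.univ)
      w w').trans (h m)
  have h2 := ENNReal.toReal_mono (by simp) h1
  simp only [ENNReal.toReal_mul, ENNReal.toReal_pow, ENNReal.toReal_div, ENNReal.toReal_one,
    ENNReal.toReal_ofNat] at h2
  linarith

theorem ProbabilityTheory.Kernel.Invariant.integral_integral [IsProbabilityMeasure π]
    (h : Kernel.Invariant Q π) {f : S → ℝ} (hf : Measurable f) {C : ℝ} (hC : ∀ s, |f s| ≤ C) :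
    ∫ w, ∫ s, f s ∂Q w ∂π = ∫ s, f s ∂π := by
  have h1 : (π ⊗ₘ Q).map Prod.snd = π := by
    have := Measure.snd_compProd π Q
    rw [Measure.snd] at this
    rw [this]; exact h
  conv_rhs => rw [← h1, integral_map measurable_snd.aemeasurable hf.aestronglyMeasurable]
  rw [Measure.integral_compProd]
  exact integrable_of_measurable_of_abs_le (hf.comp measurable_snd) fun a => hC a.2

/-- From every starting point, the expectation of a function of mean zero decays geometrically: it
is compared with the average over starting points distributed according to `π`, which vanishes. -/
theorem IsUniformlyGeometricallyErgodic.abs_integral_pow_le [IsProbabilityMeasure π]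
    (h : IsUniformlyGeometricallyErgodic Q τ) (hπ : Kernel.Invariant Q π) {f : S → ℝ}
    (hf : Measurable f) {C : ℝ} (hC : ∀ s, |f s| ≤ C) (h0 : ∫ s, f s ∂π = 0) (m : ℕ) (w : S) :
    |∫ s, f s ∂(Q ^ m) w| ≤ 2 * C * (1 / 4) ^ (m / τ) := by
  have hC0 : 0 ≤ C := (abs_nonneg _).trans (hC w)
  have hi : Integrable (fun w' => ∫ s, f s ∂(Q ^ m) w') π := by
    refine integrable_of_measurable_of_abs_le (C := C) ?_ fun w' => abs_integral_le_of_abs_le hC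
    exact hf.stronglyMeasurable.integral_kernel.measurable
  have h1 : ∫ s, f s ∂(Q ^ m) w = ∫ w', (∫ s, f s ∂(Q ^ m) w - ∫ s, f s ∂(Q ^ m) w') ∂π := by
    rw [integral_sub (integrable_const _) hi, (hπ.pow m).integral_integral hf hC, h0]
    simp
  rw [h1]
  have h2 : ∀ w', |∫ s, f s ∂(Q ^ m) w - ∫ s, f s ∂(Q ^ m) w'| ≤ 2 * C * (1 / 4) ^ (m / τ) :=
    fun w' => (abs_integral_sub_integral_le_totalVariation hf hC).trans <| by
      have := mul_le_mul_of_nonneg_left (h.totalVariation_le m w w') hC0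
      linarith
  exact abs_integral_le_of_abs_le h2

end Mixing

/-! ### The Markov property on trajectories -/

section MarkovProperty

variable {Ω S : Type*} [MeasurableSpace Ω] [MeasurableSpace S] {X : ℕ → Ω → S} {Q : Kernel S S}
  {π : Measure S} {μ : Measure Ω}

/-- The law of the whole trajectory of a process. -/
noncomputable def pathLaw (X : ℕ → Ω → S) (μ : Measure Ω) : Measure (ℕ → S) :=
  μ.map fun ω k => X k ω

theorem IsStationaryMarkovChain.measurable_path (hX : IsStationaryMarkovChain X Q π μ) :
    Measurable fun ω k => X k ω :=
  measurable_pi_lambda _ hX.measurable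

theorem IsStationaryMarkovChain.isProbabilityMeasure_pathLaw [IsProbabilityMeasure μ]
    (hX : IsStationaryMarkovChain X Q π μ) : IsProbabilityMeasure (pathLaw X μ) :=
  Measure.isProbabilityMeasure_map hX.measurable_path.aemeasurable

variable [IsMarkovKernel Q] [IsProbabilityMeasure μ]

/-- The Markov property for functions `Ψ` of the trajectory up to time `k` and of one further state:
the state at time `k + 1` is integrated out against `Q`. -/
theorem IsStationaryMarkovChain.integral_succ (hX : IsStationaryMarkovChain X Q π μ) (k : ℕ)
    {Ψ : (ℕ → S) → S → ℝ} (hΨ : Measurable (Function.uncurry Ψ)) {C : ℝ}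
    (hC : ∀ x s, |Ψ x s| ≤ C) (hdep : DependsOn Ψ (Set.Iic k)) :
    ∫ x, Ψ x (x (k + 1)) ∂pathLaw X μ = ∫ x, ∫ s, Ψ x s ∂Q (x k) ∂pathLaw X μ := by
  -- a path with the given history up to time `k`
  let ext : (Fin (k + 1) → S) → ℕ → S := fun h i => h ⟨min i k, by omega⟩
  have hext : Measurable ext := measurable_pi_lambda _ fun i => measurable_pi_apply _
  have hΨext : ∀ x : ℕ → S, Ψ (ext fun i => x i) = Ψ x := fun x => hdep fun i hi => by
    have : min i k = i := min_eq_left hi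
    simp [ext, this]
  have hhist : Measurable fun ω (i : Fin (k + 1)) => X i ω :=
    measurable_pi_lambda _ fun i => hX.measurable _
  have hlaw := hX.markov k
  have hm2 : Measurable fun p : (Fin (k + 1) → S) × S => Ψ (ext p.1) p.2 :=
    hΨ.comp ((hext.comp measurable_fst).prodMk measurable_snd)
  have hint : Integrable (fun p : (Fin (k + 1) → S) × S => Ψ (ext p.1) p.2)
      ((μ.map fun ω (i : Fin (k + 1)) => X i ω) ⊗ₘ
        (Q.comap (fun h : Fin (k + 1) → S => h (Fin.last k)) (measurable_pi_apply _))) := by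
    have : IsProbabilityMeasure (μ.map fun ω (i : Fin (k + 1)) => X i ω) :=
      Measure.isProbabilityMeasure_map hhist.aemeasurable
    exact integrable_of_measurable_of_abs_le hm2 fun p => hC _ _
  have e1 := hlaw.integral_comp hm2.aestronglyMeasurable
  have : IsProbabilityMeasure (μ.map fun ω (i : Fin (k + 1)) => X i ω) :=
    Measure.isProbabilityMeasure_map hhist.aemeasurable
  rw [Measure.integral_compProd hint] at e1
  have hm3 : Measurable fun h : Fin (k + 1) → S =>
      ∫ s, Ψ (ext h) s ∂(Q.comap (fun h : Fin (k + 1) → S => h (Fin.last k))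
        (measurable_pi_apply _)) h :=
    (hm2.stronglyMeasurable.integral_kernel_prod_right').measurable
  rw [integral_map hhist.aemeasurable hm3.aestronglyMeasurable] at e1
  have hm4 : Measurable fun x : ℕ → S => ∫ s, Ψ x s ∂Q (x k) := by
    have := (hΨ.stronglyMeasurable.integral_kernel_prod_right'
      (κ := Q.comap (fun x : ℕ → S => x k) (measurable_pi_apply _))).measurable
    exact this
  have hm5 : Measurable fun x : ℕ → S => Ψ x (x (k + 1)) :=
    hΨ.comp (measurable_id.prodMk (measurable_pi_apply (k + 1)))
  rw [pathLaw, integral_map hX.measurable_path.aemeasurable hm4.aestronglyMeasurable,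
    integral_map hX.measurable_path.aemeasurable hm5.aestronglyMeasurable]
  have hΨω : ∀ ω, Ψ (ext fun i => X i ω) = Ψ fun i => X i ω := fun ω => hΨext fun i => X i ω
  simp only [Function.comp_def, hΨω, Kernel.comap_apply, Fin.val_last] at e1
  exact e1

/-- The Markov property over `d` steps. -/
theorem IsStationaryMarkovChain.integral_add (hX : IsStationaryMarkovChain X Q π μ) (k d : ℕ)
    {Ψ : (ℕ → S) → S → ℝ} (hΨ : Measurable (Function.uncurry Ψ)) {C : ℝ}
    (hC : ∀ x s, |Ψ x s| ≤ C) (hdep : DependsOn Ψ (Set.Iic k)) :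
    ∫ x, Ψ x (x (k + d)) ∂pathLaw X μ = ∫ x, ∫ s, Ψ x s ∂(Q ^ d) (x k) ∂pathLaw X μ := by
  induction d generalizing Ψ with
  | zero =>
    refine integral_congr_ae (ae_of_all _ fun x => ?_)
    rw [pow_zero]
    change Ψ x (x k) = ∫ s, Ψ x s ∂(Kernel.id (x k))
    rw [Kernel.id_apply, integral_dirac']
    exact (hΨ.comp measurable_prodMk_left).stronglyMeasurable
  | succ d ih =>
    have h1 := hX.integral_succ (k + d) hΨ hC (hdep.mono (Set.Iic_subset_Iic.2 (by omega)))
    rw [← add_assoc, h1]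
    have hΨ' : Measurable (Function.uncurry fun (x : ℕ → S) v => ∫ s, Ψ x s ∂Q v) := by
      have hm : Measurable fun p : ((ℕ → S) × S) × S => Ψ p.1.1 p.2 :=
        hΨ.comp ((measurable_fst.comp measurable_fst).prodMk measurable_snd)
      exact (hm.stronglyMeasurable.integral_kernel_prod_right'
        (κ := Q.comap (fun p : (ℕ → S) × S => p.2) measurable_snd)).measurable
    have hdep' : DependsOn (fun (x : ℕ → S) v => ∫ s, Ψ x s ∂Q v) (Set.Iic k) := fun x y h => by
      simp only [hdep h]
    rw [ih hΨ' (fun x v => abs_integral_le_of_abs_le (hC x)) hdep']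
    refine integral_congr_ae (ae_of_all _ fun x => ?_)
    change ∫ v, ∫ s, Ψ x s ∂Q v ∂(Q ^ d) (x k) = ∫ s, Ψ x s ∂(Q ^ (d + 1)) (x k)
    rw [pow_succ']
    exact (Kernel.integral_comp (integrable_of_measurable_of_abs_le
      (m := (Q ∘ₖ (Q ^ d)) (x k)) (hΨ.comp measurable_prodMk_left) (hC x))).symm

end MarkovProperty

/-! ### Functions adapted to the trajectory -/

section Adapted

variable {S E : Type*} [MeasurableSpace S]

/-- A bounded measurable function of the trajectory that depends only on its values up to
time `t`. -/
structure IsBoundedAdapted [NormedAddCommGroup E] [MeasurableSpace E] (t : ℕ)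
    (u : (ℕ → S) → E) : Prop where
  measurable : Measurable u
  bounded : ∃ C, ∀ x, ‖u x‖ ≤ C
  dependsOn : DependsOn u (Set.Iic t)

namespace IsBoundedAdapted

variable [NormedAddCommGroup E] [MeasurableSpace E] {t : ℕ} {u v : (ℕ → S) → E}

theorem mono (hu : IsBoundedAdapted t u) {t' : ℕ} (h : t ≤ t') : IsBoundedAdapted t' u :=
  ⟨hu.measurable, hu.bounded, hu.dependsOn.mono (Set.Iic_subset_Iic.2 h)⟩

theorem integrable {u : (ℕ → S) → ℝ} (hu : IsBoundedAdapted t u) (ν : Measure (ℕ → S))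
    [IsFiniteMeasure ν] : Integrable u ν := by
  obtain ⟨C, hC⟩ := hu.bounded
  exact integrable_of_measurable_of_abs_le hu.measurable hC

theorem norm [BorelSpace E] (hu : IsBoundedAdapted t u) : IsBoundedAdapted t fun x => ‖u x‖ := by
  obtain ⟨C, hC⟩ := hu.bounded
  exact ⟨hu.measurable.norm, ⟨C, fun x => by simpa using hC x⟩,
    fun x y h => congrArg _ (hu.dependsOn h)⟩

theorem mul {u v : (ℕ → S) → ℝ} (hu : IsBoundedAdapted t u) (hv : IsBoundedAdapted t v) :
    IsBoundedAdapted t fun x => u x * v x := by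
  obtain ⟨C, hC⟩ := hu.bounded
  obtain ⟨D, hD⟩ := hv.bounded
  exact ⟨hu.measurable.mul hv.measurable, ⟨C * D, fun x => by
      rw [norm_mul]
      exact mul_le_mul (hC x) (hD x) (norm_nonneg _) ((norm_nonneg _).trans (hC x))⟩,
    fun x y h => congrArg₂ _ (hu.dependsOn h) (hv.dependsOn h)⟩

theorem norm_sq [BorelSpace E] (hu : IsBoundedAdapted t u) :
    IsBoundedAdapted t fun x => ‖u x‖ ^ 2 := by
  simpa [sq] using hu.norm.mul hu.norm

theorem smul [InnerProductSpace ℝ E] [BorelSpace E] (c : ℝ) (hu : IsBoundedAdapted t u) :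
    IsBoundedAdapted t fun x => c • u x := by
  obtain ⟨C, hC⟩ := hu.bounded
  exact ⟨hu.measurable.const_smul c, ⟨|c| * C, fun x => by
      rw [norm_smul]; exact mul_le_mul_of_nonneg_left (hC x) (abs_nonneg c)⟩,
    fun x y h => congrArg _ (hu.dependsOn h)⟩

theorem const_mul {u : (ℕ → S) → ℝ} (hu : IsBoundedAdapted t u) (c : ℝ) :
    IsBoundedAdapted t fun x => c * u x :=
  hu.smul c

theorem clm [InnerProductSpace ℝ E] [BorelSpace E]
    (A : E →L[ℝ] E) (hu : IsBoundedAdapted t u) : IsBoundedAdapted t fun x => A (u x) := by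
  obtain ⟨C, hC⟩ := hu.bounded
  exact ⟨A.continuous.measurable.comp hu.measurable, ⟨‖A‖ * C, fun x =>
      (A.le_opNorm _).trans (mul_le_mul_of_nonneg_left (hC x) (norm_nonneg A))⟩,
    fun x y h => congrArg _ (hu.dependsOn h)⟩

variable [BorelSpace E] [SecondCountableTopology E]

theorem add (hu : IsBoundedAdapted t u) (hv : IsBoundedAdapted t v) :
    IsBoundedAdapted t fun x => u x + v x := by
  obtain ⟨C, hC⟩ := hu.bounded
  obtain ⟨D, hD⟩ := hv.bounded
  exact ⟨hu.measurable.add hv.measurable,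
    ⟨C + D, fun x => (norm_add_le _ _).trans (add_le_add (hC x) (hD x))⟩,
    fun x y h => congrArg₂ _ (hu.dependsOn h) (hv.dependsOn h)⟩

theorem sum {ι : Type*} (s : Finset ι) {u : ι → (ℕ → S) → E}
    (hu : ∀ i ∈ s, IsBoundedAdapted t (u i)) : IsBoundedAdapted t fun x => ∑ i ∈ s, u i x := by
  classical
  induction s using Finset.induction_on with
  | empty => exact ⟨by simp, ⟨0, by simp⟩, fun x y _ => by simp⟩
  | insert i s hi ih =>
    simp only [Finset.sum_insert hi]
    exact (hu i (Finset.mem_insert_self _ _)).add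
      (ih fun j hj => hu j (Finset.mem_insert_of_mem hj))

variable [InnerProductSpace ℝ E]

theorem sub (hu : IsBoundedAdapted t u) (hv : IsBoundedAdapted t v) :
    IsBoundedAdapted t fun x => u x - v x := by
  have := hu.add (hv.smul (-1))
  simpa [sub_eq_add_neg] using this

theorem inner (hu : IsBoundedAdapted t u) (hv : IsBoundedAdapted t v) :
    IsBoundedAdapted t fun x => inner ℝ (u x) (v x) := by
  obtain ⟨C, hC⟩ := hu.bounded
  obtain ⟨D, hD⟩ := hv.bounded
  exact ⟨hu.measurable.inner hv.measurable, ⟨C * D, fun x =>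
      (norm_inner_le_norm _ _).trans
        (mul_le_mul (hC x) (hD x) (norm_nonneg _) ((norm_nonneg _).trans (hC x)))⟩,
    fun x y h => congrArg₂ _ (hu.dependsOn h) (hv.dependsOn h)⟩

theorem lyapunov (A : E →L[ℝ] E) (hu : IsBoundedAdapted t u) (hv : IsBoundedAdapted t v) :
    IsBoundedAdapted t fun x => lyapunov A (u x) (v x) :=
  (hu.norm_sq.add ((hu.inner hv).const_mul 2)).add ((hv.inner (hv.clm A)).const_mul 12)

end IsBoundedAdapted

end Adapted

/-! ### Bias and variance of batch averages -/

section Noise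

open scoped RealInnerProductSpace

variable {S E : Type*} [MeasurableSpace S] [NormedAddCommGroup E] [InnerProductSpace ℝ E]
  [MeasurableSpace E]

/-- A family of operators `F w`, indexed by the states of the chain, of norm at most `ρ` and of
mean zero under `π`. -/
structure IsCenteredNoise (F : S → E →L[ℝ] E) (π : Measure S) (ρ : ℝ) : Prop where
  measurable : Measurable fun p : S × E => F p.1 p.2
  norm_le : ∀ w v, ‖F w v‖ ≤ ρ * ‖v‖
  integral_eq_zero : ∀ u v, ∫ w, ⟪u, F w v⟫ ∂π = 0

/-- The average of the noise operators at the times `t + 1, …, t + m`, applied to the vector `y`,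
which may depend on the trajectory `x`. -/
noncomputable def noiseAverage (F : S → E →L[ℝ] E) (t m : ℕ) (y : (ℕ → S) → E) (x : ℕ → S) : E :=
  (m : ℝ)⁻¹ • ∑ i ∈ Finset.Icc 1 m, F (x (t + i)) (y x)

variable {F : S → E →L[ℝ] E} {π : Measure S} {ρ : ℝ} {t : ℕ} {u y : (ℕ → S) → E}

theorem IsCenteredNoise.isBoundedAdapted (hF : IsCenteredNoise F π ρ) (hρ : 0 ≤ ρ)
    (hy : IsBoundedAdapted t y) {s : ℕ} (hs : t ≤ s) :
    IsBoundedAdapted s fun x => F (x s) (y x) := by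
  obtain ⟨C, hC⟩ := hy.bounded
  exact ⟨hF.measurable.comp ((measurable_pi_apply s).prodMk hy.measurable),
    ⟨ρ * C, fun x => (hF.norm_le _ _).trans (mul_le_mul_of_nonneg_left (hC x) hρ)⟩,
    fun x x' h => by
      simp only [(hy.mono hs).dependsOn h, h s (Set.mem_Iic.2 le_rfl)]⟩

variable [BorelSpace E] [SecondCountableTopology E]

theorem IsCenteredNoise.isBoundedAdapted_sum (hF : IsCenteredNoise F π ρ) (hρ : 0 ≤ ρ)
    (hy : IsBoundedAdapted t y) (m : ℕ) :
    IsBoundedAdapted (t + m) fun x => ∑ i ∈ Finset.Icc 1 m, F (x (t + i)) (y x) :=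
  IsBoundedAdapted.sum _ fun i hi => (hF.isBoundedAdapted hρ hy (by omega)).mono
    (by have := (Finset.mem_Icc.1 hi).2; omega)

theorem IsCenteredNoise.isBoundedAdapted_noiseAverage (hF : IsCenteredNoise F π ρ) (hρ : 0 ≤ ρ)
    (hy : IsBoundedAdapted t y) (m : ℕ) : IsBoundedAdapted (t + m) (noiseAverage F t m y) :=
  (hF.isBoundedAdapted_sum hρ hy m).smul _

/-- Each value of `d / τ` is taken `τ` times, and `∑ (1 / 4) ^ q = 4 / 3`. -/
theorem sum_geometric_div_le {τ : ℕ} (hτ : 1 ≤ τ) (m : ℕ) :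
    ∑ d ∈ Finset.range m, (1 / 4 : ℝ) ^ (d / τ) ≤ 4 / 3 * τ := by
  have key : ∀ q : ℕ, ∑ d ∈ Finset.range (q * τ), (1 / 4 : ℝ) ^ (d / τ) =
      4 / 3 * τ * (1 - (1 / 4) ^ q) := by
    intro q
    induction q with
    | zero => simp
    | succ q ih =>
      rw [Nat.succ_mul, Finset.sum_range_add, ih]
      have : ∀ i ∈ Finset.range τ, (1 / 4 : ℝ) ^ ((q * τ + i) / τ) = (1 / 4) ^ q := by
        intro i hi
        rw [mul_comm, Nat.mul_add_div (by omega), Nat.div_eq_of_lt (Finset.mem_range.1 hi),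
          add_zero]
      rw [Finset.sum_congr rfl this, Finset.sum_const, Finset.card_range, nsmul_eq_mul, pow_succ]
      ring
  have hm : m ≤ m * τ := Nat.le_mul_of_pos_right _ hτ
  refine (Finset.sum_le_sum_of_subset_of_nonneg (Finset.range_mono hm)
    fun _ _ _ => by positivity).trans ?_
  rw [key]
  have h1 : (0 : ℝ) ≤ (1 / 4) ^ m := by positivity
  have h2 : (0 : ℝ) ≤ 4 / 3 * τ := by positivity
  nlinarith

variable {Ω : Type*} [MeasurableSpace Ω] {X : ℕ → Ω → S} {Q : Kernel S S} [IsMarkovKernel Q]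
  {μ : Measure Ω} [IsProbabilityMeasure μ] {τ : ℕ}

/-- The noise at time `t + d` is nearly uncorrelated with the trajectory up to time `t`. -/
theorem IsCenteredNoise.abs_integral_inner_le (hF : IsCenteredNoise F π ρ) (hρ : 0 ≤ ρ)
    (hX : IsStationaryMarkovChain X Q π μ) (hQ : IsUniformlyGeometricallyErgodic Q τ)
    (hu : IsBoundedAdapted t u) (hy : IsBoundedAdapted t y) (d : ℕ) :
    |∫ x, ⟪u x, F (x (t + d)) (y x)⟫ ∂pathLaw X μ| ≤
      2 * ρ * (1 / 4) ^ (d / τ) * ∫ x, ‖u x‖ * ‖y x‖ ∂pathLaw X μ := by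
  have := hX.isProbabilityMeasure
  have := hX.isProbabilityMeasure_pathLaw
  obtain ⟨C, hC⟩ := hu.bounded
  obtain ⟨D, hD⟩ := hy.bounded
  have hpt : ∀ x s, |⟪u x, F s (y x)⟫| ≤ ρ * (‖u x‖ * ‖y x‖) := fun x s =>
    (abs_real_inner_le_norm _ _).trans <| by
      have := mul_le_mul_of_nonneg_left (hF.norm_le s (y x)) (norm_nonneg (u x))
      linarith
  have hmeas : Measurable (Function.uncurry fun x s => ⟪u x, F s (y x)⟫) :=
    (hu.measurable.comp measurable_fst).inner
      (hF.measurable.comp (measurable_snd.prodMk (hy.measurable.comp measurable_fst)))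
  rw [hX.integral_add t d (Ψ := fun x s => ⟪u x, F s (y x)⟫) hmeas (C := ρ * (C * D))
    (fun x s => (hpt x s).trans <| by
      have := hC x; have := hD x; have := (norm_nonneg _).trans (hC x); gcongr)
    (fun x x' h => by simp only [hu.dependsOn h, hy.dependsOn h])]
  rw [← integral_const_mul]
  have hb : ∀ x : ℕ → S, ‖∫ s, ⟪u x, F s (y x)⟫ ∂(Q ^ d) (x t)‖ ≤
      2 * ρ * (1 / 4) ^ (d / τ) * (‖u x‖ * ‖y x‖) := fun x =>
    (hQ.abs_integral_pow_le hX.invariant (hmeas.comp measurable_prodMk_left) (hpt x)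
      (hF.integral_eq_zero (u x) (y x)) d (x t)).trans (le_of_eq (by ring))
  exact norm_integral_le_of_norm_le
    (((hu.norm.mul hy.norm).integrable (pathLaw X μ)).const_mul _) (ae_of_all _ hb)

/-- The bias of a sum of consecutive noise terms does not grow with the number of terms. -/
theorem IsCenteredNoise.abs_integral_inner_sum_le (hF : IsCenteredNoise F π ρ) (hρ : 0 ≤ ρ)
    (hX : IsStationaryMarkovChain X Q π μ) (hQ : IsUniformlyGeometricallyErgodic Q τ)
    (hτ : 1 ≤ τ) (hu : IsBoundedAdapted t u) (hy : IsBoundedAdapted t y) (m : ℕ) :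
    |∫ x, ⟪u x, ∑ i ∈ Finset.Icc 1 m, F (x (t + i)) (y x)⟫ ∂pathLaw X μ| ≤
      8 / 3 * τ * ρ * ∫ x, ‖u x‖ * ‖y x‖ ∂pathLaw X μ := by
  have := hX.isProbabilityMeasure_pathLaw
  have hI : 0 ≤ ∫ x, ‖u x‖ * ‖y x‖ ∂pathLaw X μ := integral_nonneg fun x => by positivity
  simp only [inner_sum]
  rw [integral_finsetSum _ fun i _ =>
    ((hu.mono (by omega : t ≤ t + i)).inner (hF.isBoundedAdapted hρ hy (by omega))).integrable _]
  refine (Finset.abs_sum_le_sum_abs _ _).trans ((Finset.sum_le_sum fun i _ =>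
    hF.abs_integral_inner_le hρ hX hQ hu hy i).trans ?_)
  rw [← Finset.sum_mul, ← Finset.mul_sum]
  have h1 : ∑ i ∈ Finset.Icc 1 m, (1 / 4 : ℝ) ^ (i / τ) ≤ 4 / 3 * τ :=
    (Finset.sum_le_sum_of_subset_of_nonneg (t := Finset.range (m + 1))
      (fun i hi => Finset.mem_range.2 (by have := (Finset.mem_Icc.1 hi).2; omega))
      fun _ _ _ => by positivity).trans (sum_geometric_div_le hτ _)
  refine mul_le_mul_of_nonneg_right ?_ hI
  nlinarith [mul_le_mul_of_nonneg_left h1 (by positivity : 0 ≤ 2 * ρ)]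

/-- The second moment of a sum of consecutive noise terms grows linearly in their number: the new
term is nearly uncorrelated with all but about `τ` of its predecessors. -/
theorem IsCenteredNoise.integral_norm_sum_sq_le (hF : IsCenteredNoise F π ρ) (hρ : 0 ≤ ρ)
    (hX : IsStationaryMarkovChain X Q π μ) (hQ : IsUniformlyGeometricallyErgodic Q τ)
    (hτ : 1 ≤ τ) (hy : IsBoundedAdapted t y) (m : ℕ) :
    ∫ x, ‖∑ i ∈ Finset.Icc 1 m, F (x (t + i)) (y x)‖ ^ 2 ∂pathLaw X μ ≤
      m * (19 / 3 * τ * ρ ^ 2 * ∫ x, ‖y x‖ ^ 2 ∂pathLaw X μ) := by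
  have := hX.isProbabilityMeasure_pathLaw
  have hI : 0 ≤ ∫ x, ‖y x‖ ^ 2 ∂pathLaw X μ := integral_nonneg fun x => by positivity
  have hτ' : (1 : ℝ) ≤ τ := by exact_mod_cast hτ
  induction m with
  | zero => simp
  | succ m ih =>
    have hS := (hF.isBoundedAdapted_sum hρ hy m).mono (by omega : t + m ≤ t + (m + 1))
    have hf : ∀ i, IsBoundedAdapted (t + i) fun x => F (x (t + i)) (y x) := fun i =>
      hF.isBoundedAdapted hρ hy (by omega)
    have hN := hf (m + 1)
    have e : ∀ x : ℕ → S, ‖∑ i ∈ Finset.Icc 1 (m + 1), F (x (t + i)) (y x)‖ ^ 2 =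
        ‖∑ i ∈ Finset.Icc 1 m, F (x (t + i)) (y x)‖ ^ 2 +
        2 * ⟪∑ i ∈ Finset.Icc 1 m, F (x (t + i)) (y x), F (x (t + (m + 1))) (y x)⟫ +
        ‖F (x (t + (m + 1))) (y x)‖ ^ 2 := fun x => by
      rw [Finset.sum_Icc_succ_top (by omega), norm_add_sq_real]
    simp only [e]
    rw [integral_add ((hS.norm_sq.add ((hS.inner hN).const_mul 2)).integrable _)
      (hN.norm_sq.integrable _), integral_add (hS.norm_sq.integrable _)
      (((hS.inner hN).integrable _).const_mul 2), integral_const_mul]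
    have h1 : ∫ x, ‖F (x (t + (m + 1))) (y x)‖ ^ 2 ∂pathLaw X μ ≤
        ρ ^ 2 * ∫ x, ‖y x‖ ^ 2 ∂pathLaw X μ := by
      rw [← integral_const_mul]
      refine integral_mono (hN.norm_sq.integrable _) ((hy.norm_sq.integrable _).const_mul _)
        fun x => ?_
      simp only [← mul_pow]
      exact pow_le_pow_left₀ (norm_nonneg _) (hF.norm_le _ _) 2
    have h2 : ∫ x, ⟪∑ i ∈ Finset.Icc 1 m, F (x (t + i)) (y x),
        F (x (t + (m + 1))) (y x)⟫ ∂pathLaw X μ ≤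
        8 / 3 * τ * ρ ^ 2 * ∫ x, ‖y x‖ ^ 2 ∂pathLaw X μ := by
      simp only [sum_inner]
      rw [integral_finsetSum _ fun i hi => (((hf i).mono (by
        have := (Finset.mem_Icc.1 hi).2; omega : t + i ≤ t + (m + 1))).inner hN).integrable _]
      have h3 : ∀ i ∈ Finset.Icc 1 m,
          ∫ x, ⟪F (x (t + i)) (y x), F (x (t + (m + 1))) (y x)⟫ ∂pathLaw X μ ≤
          2 * ρ ^ 2 * (∫ x, ‖y x‖ ^ 2 ∂pathLaw X μ) * (1 / 4) ^ ((m + 1 - i) / τ) := by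
        intro i hi
        have hi2 := (Finset.mem_Icc.1 hi).2
        have h4 := hF.abs_integral_inner_le hρ hX hQ (hf i) (hy.mono (by omega : t ≤ t + i))
          (m + 1 - i)
        rw [show t + i + (m + 1 - i) = t + (m + 1) by omega] at h4
        refine (le_abs_self _).trans (h4.trans ?_)
        have h5 : ∫ x, ‖F (x (t + i)) (y x)‖ * ‖y x‖ ∂pathLaw X μ ≤
            ρ * ∫ x, ‖y x‖ ^ 2 ∂pathLaw X μ := by
          rw [← integral_const_mul]
          refine integral_mono (((hf i).norm.mul (hy.norm.mono (by omega))).integrable _)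
            ((hy.norm_sq.integrable _).const_mul _) fun x => ?_
          have := mul_le_mul_of_nonneg_right (hF.norm_le (x (t + i)) (y x)) (norm_nonneg (y x))
          simp only
          linarith
        have := mul_le_mul_of_nonneg_left h5
          (by positivity : 0 ≤ 2 * ρ * (1 / 4) ^ ((m + 1 - i) / τ))
        linarith
      refine (Finset.sum_le_sum h3).trans ?_
      rw [← Finset.mul_sum]
      have h6 : ∑ i ∈ Finset.Icc 1 m, (1 / 4 : ℝ) ^ ((m + 1 - i) / τ) ≤ 4 / 3 * τ := by
        refine le_trans (le_of_eq ?_) ((Finset.sum_le_sum_of_subset_of_nonneg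
          (s := Finset.Icc 1 m) (t := Finset.range (m + 1))
          (fun i hi => Finset.mem_range.2 (by have := (Finset.mem_Icc.1 hi).2; omega))
          fun _ _ _ => by positivity).trans (sum_geometric_div_le hτ (m + 1)))
        refine Finset.sum_nbij' (fun i => m + 1 - i) (fun i => m + 1 - i) ?_ ?_ ?_ ?_ ?_ <;>
          intro i hi <;> simp only [Finset.mem_Icc] at hi ⊢ <;> omega
      have := mul_le_mul_of_nonneg_left h6
        (by positivity : 0 ≤ 2 * ρ ^ 2 * (∫ x, ‖y x‖ ^ 2 ∂pathLaw X μ))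
      linarith
    have h7 : 0 ≤ (τ - 1 : ℝ) * (ρ ^ 2 * ∫ x, ‖y x‖ ^ 2 ∂pathLaw X μ) :=
      mul_nonneg (by linarith) (by positivity)
    push_cast
    linarith

theorem IsCenteredNoise.abs_integral_inner_noiseAverage_le (hF : IsCenteredNoise F π ρ)
    (hρ : 0 ≤ ρ) (hX : IsStationaryMarkovChain X Q π μ)
    (hQ : IsUniformlyGeometricallyErgodic Q τ) (hτ : 1 ≤ τ) (hu : IsBoundedAdapted t u)
    (hy : IsBoundedAdapted t y) (m : ℕ) :
    |∫ x, ⟪u x, noiseAverage F t m y x⟫ ∂pathLaw X μ| ≤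
      8 / 3 * τ * ρ / m * ∫ x, ‖u x‖ * ‖y x‖ ∂pathLaw X μ := by
  simp only [noiseAverage, real_inner_smul_right]
  rw [integral_const_mul, abs_mul, abs_of_nonneg (by positivity : (0 : ℝ) ≤ (m : ℝ)⁻¹)]
  have := mul_le_mul_of_nonneg_left (hF.abs_integral_inner_sum_le hρ hX hQ hτ hu hy m)
    (by positivity : (0 : ℝ) ≤ (m : ℝ)⁻¹)
  refine this.trans (le_of_eq ?_)
  ring

theorem IsCenteredNoise.integral_norm_noiseAverage_sq_le (hF : IsCenteredNoise F π ρ)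
    (hρ : 0 ≤ ρ) (hX : IsStationaryMarkovChain X Q π μ)
    (hQ : IsUniformlyGeometricallyErgodic Q τ) (hτ : 1 ≤ τ)
    (hy : IsBoundedAdapted t y) {m : ℕ} (hm : m ≠ 0) :
    ∫ x, ‖noiseAverage F t m y x‖ ^ 2 ∂pathLaw X μ ≤
      19 / 3 * τ * ρ ^ 2 / m * ∫ x, ‖y x‖ ^ 2 ∂pathLaw X μ := by
  simp only [noiseAverage, norm_smul, mul_pow]
  rw [integral_const_mul]
  have hm' : (m : ℝ) ≠ 0 := by exact_mod_cast hm
  have := mul_le_mul_of_nonneg_left (hF.integral_norm_sum_sq_le hρ hX hQ hτ hy m)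
    (by positivity : (0 : ℝ) ≤ ‖(m : ℝ)⁻¹‖ ^ 2)
  refine this.trans (le_of_eq ?_)
  rw [norm_inv, Real.norm_natCast]
  field_simp

end Noise

/-! ### The multilevel estimator -/

section Multilevel

open scoped RealInnerProductSpace

/-- The expectation of `f (min J (K + 1))` for a geometric variable `J` on `{1, 2, …}` with
parameter `1 / 2`. -/
noncomputable def levelMean (K : ℕ) (f : ℕ → ℝ) : ℝ :=
  ∑ j ∈ Finset.Icc 1 K, (1 / 2 : ℝ) ^ j * f j + (1 / 2) ^ K * f (K + 1)

theorem levelMean_mono {K : ℕ} {f g : ℕ → ℝ} (h : ∀ j ∈ Finset.Icc 1 (K + 1), f j ≤ g j) :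
    levelMean K f ≤ levelMean K g := by
  refine add_le_add (Finset.sum_le_sum fun j hj => ?_) ?_
  · exact mul_le_mul_of_nonneg_left
      (h j (Finset.Icc_subset_Icc_right (Nat.le_succ K) hj)) (by positivity)
  · exact mul_le_mul_of_nonneg_left (h _ (by simp)) (by positivity)

theorem levelMean_add (K : ℕ) (f g : ℕ → ℝ) :
    levelMean K (fun j => f j + g j) = levelMean K f + levelMean K g := by
  simp only [levelMean, mul_add, Finset.sum_add_distrib]
  ring

theorem levelMean_const_mul (K : ℕ) (c : ℝ) (f : ℕ → ℝ) :
    levelMean K (fun j => c * f j) = c * levelMean K f := by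
  simp only [levelMean, mul_add, Finset.mul_sum]
  congr 1
  · exact Finset.sum_congr rfl fun j _ => by ring
  · ring

theorem levelMean_const (K : ℕ) (c : ℝ) : levelMean K (fun _ => c) = c := by
  induction K with
  | zero => simp [levelMean]
  | succ K ih =>
    rw [levelMean, Finset.sum_Icc_succ_top (by omega)]
    rw [levelMean] at ih
    rw [pow_succ]
    linarith

/-- The corrections of the multilevel estimator telescope in expectation. -/
theorem levelMean_telescope (K : ℕ) (a : ℕ → ℝ) :
    levelMean K (fun j => if j ≤ K then (2 : ℝ) ^ j * (a j - a (j - 1)) else 0) = a K - a 0 := by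
  have h : levelMean K (fun j => if j ≤ K then (2 : ℝ) ^ j * (a j - a (j - 1)) else 0) =
      ∑ j ∈ Finset.Icc 1 K, (a j - a (j - 1)) := by
    rw [levelMean, if_neg (by omega), mul_zero, add_zero]
    refine Finset.sum_congr rfl fun j hj => ?_
    rw [if_pos (Finset.mem_Icc.1 hj).2, ← mul_assoc, ← mul_pow]
    norm_num
  rw [h]
  clear h
  induction K with
  | zero => simp
  | succ K ih => rw [Finset.sum_Icc_succ_top (by omega), ih]; simp

variable {S E : Type*} [MeasurableSpace S] [NormedAddCommGroup E] [InnerProductSpace ℝ E]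

/-- The error of the multilevel estimator at level `j`: above the largest level `K` it is that of
the plain batch average. -/
noncomputable def multilevelError (F : S → E →L[ℝ] E) (K B t : ℕ) (y : (ℕ → S) → E) (j : ℕ)
    (x : ℕ → S) : E :=
  noiseAverage F t B y x + if j ≤ K then
    (2 : ℝ) ^ j • (noiseAverage F t (2 ^ j * B) y x - noiseAverage F t (2 ^ (j - 1) * B) y x)
  else 0

variable [MeasurableSpace E] [BorelSpace E] [SecondCountableTopology E] {F : S → E →L[ℝ] E}
  {π : Measure S} {ρ : ℝ} {t : ℕ} {u v y : (ℕ → S) → E}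

theorem IsCenteredNoise.isBoundedAdapted_multilevelError (hF : IsCenteredNoise F π ρ) (hρ : 0 ≤ ρ)
    (hy : IsBoundedAdapted t y) (K B j : ℕ) :
    IsBoundedAdapted (t + 2 ^ j * B) (multilevelError F K B t y j) := by
  have h1 : B ≤ 2 ^ j * B := Nat.le_mul_of_pos_left _ (by positivity)
  have h2 : 2 ^ (j - 1) * B ≤ 2 ^ j * B :=
    Nat.mul_le_mul_right _ (Nat.pow_le_pow_right (by omega) (by omega))
  have h0 := (hF.isBoundedAdapted_noiseAverage hρ hy B).mono (Nat.add_le_add_left h1 t)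
  unfold multilevelError
  by_cases h : j ≤ K
  · simp only [if_pos h]
    exact h0.add (((hF.isBoundedAdapted_noiseAverage hρ hy _).sub
      ((hF.isBoundedAdapted_noiseAverage hρ hy _).mono (Nat.add_le_add_left h2 t))).smul _)
  · simpa only [if_neg h, add_zero] using h0

variable {Ω : Type*} [MeasurableSpace Ω] {X : ℕ → Ω → S} {Q : Kernel S S} [IsMarkovKernel Q]
  {μ : Measure Ω} [IsProbabilityMeasure μ] {τ : ℕ}

/-- Averaged over the level, the multilevel estimator has the bias of a batch of size
`2 ^ K * B`. -/
theorem IsCenteredNoise.levelMean_integral_inner_le (hF : IsCenteredNoise F π ρ)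
    (hρ : 0 ≤ ρ) (hX : IsStationaryMarkovChain X Q π μ)
    (hQ : IsUniformlyGeometricallyErgodic Q τ) (hτ : 1 ≤ τ) (hu : IsBoundedAdapted t u)
    (hy : IsBoundedAdapted t y) (K B : ℕ) :
    |levelMean K fun j => ∫ x, ⟪u x, multilevelError F K B t y j x⟫ ∂pathLaw X μ| ≤
      8 / 3 * τ * ρ / ((2 : ℝ) ^ K * B) * ∫ x, ‖u x‖ * ‖y x‖ ∂pathLaw X μ := by
  have := hX.isProbabilityMeasure_pathLaw
  set a : ℕ → ℝ := fun j => ∫ x, ⟪u x, noiseAverage F t (2 ^ j * B) y x⟫ ∂pathLaw X μ with ha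
  have hi : ∀ m, Integrable (fun x => ⟪u x, noiseAverage F t m y x⟫) (pathLaw X μ) := fun m =>
    ((hu.mono (by omega : t ≤ t + m)).inner
      (hF.isBoundedAdapted_noiseAverage hρ hy m)).integrable _
  have e : ∀ j, ∫ x, ⟪u x, multilevelError F K B t y j x⟫ ∂pathLaw X μ =
      a 0 + if j ≤ K then (2 : ℝ) ^ j * (a j - a (j - 1)) else 0 := fun j => by
    have h0 : a 0 = ∫ x, ⟪u x, noiseAverage F t B y x⟫ ∂pathLaw X μ := by simp [ha]
    unfold multilevelError
    split_ifs with h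
    · simp only [inner_add_right, real_inner_smul_right, inner_sub_right]
      have hs : Integrable (fun x => ⟪u x, noiseAverage F t (2 ^ j * B) y x⟫ -
          ⟪u x, noiseAverage F t (2 ^ (j - 1) * B) y x⟫) (pathLaw X μ) := (hi _).sub (hi _)
      rw [integral_add (hi _) (hs.const_mul _), integral_const_mul,
        integral_sub (hi _) (hi _), h0]
    · simp only [add_zero, h0]
  simp only [e]
  rw [levelMean_add, levelMean_const, levelMean_telescope, add_sub_cancel]
  have := hF.abs_integral_inner_noiseAverage_le hρ hX hQ hτ hu hy (2 ^ K * B)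
  push_cast at this
  exact this

/-- Level `j` has probability `2 ^ (-j)` and an error of second moment `O(2 ^ j / B)`, so each of
the `K` levels contributes the same amount. -/
theorem IsCenteredNoise.levelMean_integral_norm_sq_le (hF : IsCenteredNoise F π ρ)
    (hρ : 0 ≤ ρ) (hX : IsStationaryMarkovChain X Q π μ)
    (hQ : IsUniformlyGeometricallyErgodic Q τ) (hτ : 1 ≤ τ)
    (hy : IsBoundedAdapted t y) (K : ℕ) {B : ℕ} (hB : B ≠ 0) :
    levelMean K (fun j => ∫ x, ‖multilevelError F K B t y j x‖ ^ 2 ∂pathLaw X μ) ≤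
      19 / 3 * τ * ρ ^ 2 * (2 + 12 * K) / B * ∫ x, ‖y x‖ ^ 2 ∂pathLaw X μ := by
  have := hX.isProbabilityMeasure_pathLaw
  have hI : 0 ≤ ∫ x, ‖y x‖ ^ 2 ∂pathLaw X μ := integral_nonneg fun x => by positivity
  set s : ℝ := 19 / 3 * τ * ρ ^ 2 / B * ∫ x, ‖y x‖ ^ 2 ∂pathLaw X μ with hs
  have hs0 : 0 ≤ s := by positivity
  have hi : ∀ m, Integrable (fun x => ‖noiseAverage F t m y x‖ ^ 2) (pathLaw X μ) := fun m =>
    (hF.isBoundedAdapted_noiseAverage hρ hy m).norm_sq.integrable _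
  have hv : ∀ j : ℕ, ∫ x, ‖noiseAverage F t (2 ^ j * B) y x‖ ^ 2 ∂pathLaw X μ ≤
      (1 / 2) ^ j * s := fun j => by
    refine (hF.integral_norm_noiseAverage_sq_le hρ hX hQ hτ hy
      (mul_ne_zero (by positivity) hB)).trans (le_of_eq ?_)
    rw [hs]
    push_cast
    rw [one_div_pow]
    field_simp
  have h0 : ∫ x, ‖noiseAverage F t B y x‖ ^ 2 ∂pathLaw X μ ≤ s := by simpa using hv 0
  -- the bound `2 s + 12 s 2 ^ j` is written with the differences of `s * j`, so that its mean
  -- over the levels telescopes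
  have hb : ∀ j ∈ Finset.Icc 1 (K + 1),
      ∫ x, ‖multilevelError F K B t y j x‖ ^ 2 ∂pathLaw X μ ≤
      2 * s + 12 * (if j ≤ K then (2 : ℝ) ^ j * (s * j - s * (j - 1 : ℕ)) else 0) := by
    intro j hj
    have hj1 := (Finset.mem_Icc.1 hj).1
    split_ifs with h
    · have hpt : ∀ x, ‖multilevelError F K B t y j x‖ ^ 2 ≤
          2 * ‖noiseAverage F t B y x‖ ^ 2 + 4 * ((2 : ℝ) ^ j) ^ 2 *
            (‖noiseAverage F t (2 ^ j * B) y x‖ ^ 2 +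
              ‖noiseAverage F t (2 ^ (j - 1) * B) y x‖ ^ 2) := fun x => by
        rw [multilevelError, if_pos h]
        have k1 := parallelogram_law_with_norm ℝ (noiseAverage F t B y x) ((2 : ℝ) ^ j •
          (noiseAverage F t (2 ^ j * B) y x - noiseAverage F t (2 ^ (j - 1) * B) y x))
        have k2 := parallelogram_law_with_norm ℝ (noiseAverage F t (2 ^ j * B) y x)
          (noiseAverage F t (2 ^ (j - 1) * B) y x)
        rw [norm_smul ((2 : ℝ) ^ j), Real.norm_of_nonneg (by positivity)] at k1
        have k3 := mul_nonneg (sq_nonneg ((2 : ℝ) ^ j)) (sq_nonneg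
          ‖noiseAverage F t (2 ^ j * B) y x + noiseAverage F t (2 ^ (j - 1) * B) y x‖)
        have k4 := mul_nonneg (sq_nonneg ((2 : ℝ) ^ j)) (sq_nonneg
          ‖noiseAverage F t B y x - (2 : ℝ) ^ j • (noiseAverage F t (2 ^ j * B) y x -
            noiseAverage F t (2 ^ (j - 1) * B) y x)‖)
        have k5 := sq_nonneg
          ‖noiseAverage F t B y x - (2 : ℝ) ^ j • (noiseAverage F t (2 ^ j * B) y x -
            noiseAverage F t (2 ^ (j - 1) * B) y x)‖
        have k6 := congrArg (fun r => ((2 : ℝ) ^ j) ^ 2 * r) k2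
        linarith
      refine (integral_mono ((hF.isBoundedAdapted_multilevelError hρ hy K B j).norm_sq.integrable _)
        (((hi _).const_mul 2).fun_add (((hi _).fun_add (hi _)).const_mul _)) hpt).trans ?_
      rw [integral_add ((hi _).const_mul 2) (((hi _).fun_add (hi _)).const_mul _),
        integral_const_mul, integral_const_mul, integral_add (hi _) (hi _)]
      have e1 : s * (j : ℝ) - s * (j - 1 : ℕ) = s := by
        rw [Nat.cast_sub hj1]; push_cast; ring
      have e2 : (1 / 2 : ℝ) ^ (j - 1) = 2 * (1 / 2) ^ j := by
        obtain ⟨i, rfl⟩ := Nat.exists_eq_add_of_le' hj1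
        rw [Nat.add_sub_cancel, pow_succ]; ring
      have e3 : ((2 : ℝ) ^ j) ^ 2 * (1 / 2) ^ j = 2 ^ j := by
        rw [sq, mul_assoc, ← mul_pow]; norm_num
      have k1 := hv j
      have k2 := hv (j - 1)
      rw [e2] at k2
      rw [e1]
      have k3 := mul_le_mul_of_nonneg_left (add_le_add k1 k2)
        (by positivity : 0 ≤ 4 * ((2 : ℝ) ^ j) ^ 2)
      have e4 : 4 * ((2 : ℝ) ^ j) ^ 2 * ((1 / 2) ^ j * s + 2 * (1 / 2) ^ j * s) =
          12 * (2 ^ j * s) := by linear_combination 12 * s * e3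
      linarith
    · rw [mul_zero, add_zero]
      simp only [multilevelError, if_neg h, add_zero]
      linarith
  refine (levelMean_mono hb).trans (le_of_eq ?_)
  rw [levelMean_add, levelMean_const, levelMean_const_mul,
    levelMean_telescope K fun j : ℕ => s * (j : ℝ), hs]
  push_cast
  ring

/-- The effect of the multilevel estimator on the Lyapunov function, averaged over the level and
the chain: a bias term and a variance term are added to the noiseless value. -/
theorem IsCenteredNoise.levelMean_integral_lyapunov_le (hF : IsCenteredNoise F π ρ)
    (hρ : 0 ≤ ρ) (hX : IsStationaryMarkovChain X Q π μ)
    (hQ : IsUniformlyGeometricallyErgodic Q τ) (hτ : 1 ≤ τ) {A : E →L[ℝ] E}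
    (hA : ∀ v w, ⟪A v, w⟫ = ⟪v, A w⟫) {β : ℝ} (hβ0 : 0 ≤ β) (hβ : β ≤ 1 / 4)
    (hAβ : ∀ v, 16 * β ^ 2 * ⟪v, A v⟫ ≤ ‖v‖ ^ 2)
    (hu : IsBoundedAdapted t u) (hv : IsBoundedAdapted t v)
    (hy : IsBoundedAdapted t y) (K : ℕ) {B : ℕ} (hB : B ≠ 0) :
    levelMean K (fun j => ∫ x, lyapunov A (u x - (3 * β) • multilevelError F K B t y j x)
        (v x - (3 * β ^ 2) • multilevelError F K B t y j x) ∂pathLaw X μ) ≤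
      ∫ x, (lyapunov A (u x) (v x) +
        8 / 3 * τ * ρ / ((2 : ℝ) ^ K * B) * (‖errorDirection A β (u x) (v x)‖ * ‖y x‖) +
        81 / 4 * β ^ 2 * (19 / 3 * τ * ρ ^ 2 * (2 + 12 * K) / B) * ‖y x‖ ^ 2) ∂pathLaw X μ := by
  have := hX.isProbabilityMeasure_pathLaw
  have hl : IsBoundedAdapted t fun x => errorDirection A β (u x) (v x) :=
    ((hu.smul _).add (hv.smul _)).add ((hv.clm A).smul _)
  have hξ : ∀ j, IsBoundedAdapted (t + 2 ^ j * B) (multilevelError F K B t y j) :=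
    hF.isBoundedAdapted_multilevelError hρ hy K B
  have i1 := (hu.lyapunov A hv).integrable (pathLaw X μ)
  have i2 := (hl.norm.mul hy.norm).integrable (pathLaw X μ)
  have i3 := hy.norm_sq.integrable (pathLaw X μ)
  have hb : ∀ j, ∫ x, lyapunov A (u x - (3 * β) • multilevelError F K B t y j x)
        (v x - (3 * β ^ 2) • multilevelError F K B t y j x) ∂pathLaw X μ ≤
      ∫ x, lyapunov A (u x) (v x) ∂pathLaw X μ + ((-1) *
        (∫ x, ⟪errorDirection A β (u x) (v x), multilevelError F K B t y j x⟫ ∂pathLaw X μ) +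
      81 / 4 * β ^ 2 * ∫ x, ‖multilevelError F K B t y j x‖ ^ 2 ∂pathLaw X μ) := by
    intro j
    have hm : t ≤ t + 2 ^ j * B := by omega
    have j1 := (((hu.mono hm).sub ((hξ j).smul (3 * β))).lyapunov A
      ((hv.mono hm).sub ((hξ j).smul (3 * β ^ 2)))).integrable (pathLaw X μ)
    have j2 := ((hl.mono hm).inner (hξ j)).integrable (pathLaw X μ)
    have j3 := (hξ j).norm_sq.integrable (pathLaw X μ)
    rw [← integral_const_mul, ← integral_const_mul, ← integral_add (j2.const_mul _)
      (j3.const_mul _), ← integral_add i1 ((j2.const_mul _).fun_add (j3.const_mul _))]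
    refine integral_mono j1 (i1.fun_add ((j2.const_mul _).fun_add (j3.const_mul _))) fun x => ?_
    have := lyapunov_sub_smul_le hA hβ0 hβ hAβ (u x) (v x) (multilevelError F K B t y j x)
    linarith
  refine (levelMean_mono fun j _ => hb j).trans ?_
  rw [levelMean_add, levelMean_const, levelMean_add, levelMean_const_mul, levelMean_const_mul,
    integral_add (i1.fun_add (i2.const_mul _)) (i3.const_mul _), integral_add i1 (i2.const_mul _),
    integral_const_mul, integral_const_mul]
  have k1 := (abs_le.1 (hF.levelMean_integral_inner_le hρ hX hQ hτ hl hy K B)).1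
  have k2 := mul_le_mul_of_nonneg_left (hF.levelMean_integral_norm_sq_le hρ hX hQ hτ hy K hB)
    (by positivity : 0 ≤ 81 / 4 * β ^ 2)
  linarith

end Multilevel

/-! ### Centring the gossip matrices -/

section Algorithm

open scoped RealInnerProductSpace

variable {n : ℕ}

/-- The matrix `c⁻¹ W` as an operator on Euclidean space. -/
noncomputable def scaledOp (c : ℝ) (W : Matrix (Fin n) (Fin n) ℝ) :
    EuclideanSpace ℝ (Fin n) →L[ℝ] EuclideanSpace ℝ (Fin n) :=
  c⁻¹ • Matrix.toEuclideanCLM (𝕜 := ℝ) W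

theorem scaledOp_apply (c : ℝ) (W : Matrix (Fin n) (Fin n) ℝ) (x : EuclideanSpace ℝ (Fin n)) :
    scaledOp c W x = c⁻¹ • mulVecE W x := rfl

theorem abs_entry_le_spectralNorm2 (W : Matrix (Fin n) (Fin n) ℝ) (i j : Fin n) :
    |W i j| ≤ spectralNorm2 W := by
  have h : ⟪EuclideanSpace.single i (1 : ℝ), Matrix.toEuclideanCLM (𝕜 := ℝ) W
      (EuclideanSpace.single j 1)⟫ = W i j := by
    rw [Matrix.inner_toEuclideanCLM]
    simp
  rw [← h]
  refine (abs_real_inner_le_norm _ _).trans ?_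
  have := (Matrix.toEuclideanCLM (𝕜 := ℝ) W).le_opNorm (EuclideanSpace.single j 1)
  simpa [spectralNorm2] using this

/-- The deviations `(w - Wt) / c` of the gossip matrices are centred noise of size `ρ / c`. -/
theorem isCenteredNoise_scaledOp {WG : Set (Matrix (Fin n) (Fin n) ℝ)} [MeasurableSpace WG]
    (hmeas : ∀ i j, Measurable fun w : WG => (w : Matrix (Fin n) (Fin n) ℝ) i j)
    {π : Measure WG} [IsProbabilityMeasure π] {Wt : Matrix (Fin n) (Fin n) ℝ}
    (hmean : ∀ i j, ∫ w : WG, (w : Matrix (Fin n) (Fin n) ℝ) i j ∂π = Wt i j) {ρ : ℝ}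
    (hρ : ∀ w ∈ WG, spectralNorm2 (w - Wt) ≤ ρ) {c : ℝ} (hc : 0 < c) :
    IsCenteredNoise (fun w : WG => scaledOp c ((w : Matrix (Fin n) (Fin n) ℝ) - Wt)) π
      (ρ / c) where
  measurable := by
    have : (fun p : WG × EuclideanSpace ℝ (Fin n) =>
        scaledOp c ((p.1 : Matrix (Fin n) (Fin n) ℝ) - Wt) p.2) = fun p => c⁻¹ •
          WithLp.toLp 2 fun i => ∑ j, ((p.1 : Matrix (Fin n) (Fin n) ℝ) i j - Wt i j) * p.2 j := by
      funext p
      rfl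
    have hv : ∀ j, Measurable fun v : EuclideanSpace ℝ (Fin n) => v j := fun j =>
      (measurable_pi_apply j).comp (WithLp.measurable_ofLp 2 (Fin n → ℝ))
    have hc : Measurable fun p : WG × EuclideanSpace ℝ (Fin n) => fun i =>
        ∑ j, ((p.1 : Matrix (Fin n) (Fin n) ℝ) i j - Wt i j) * p.2 j :=
      measurable_pi_lambda _ fun i => Finset.measurable_sum _ fun j _ =>
        (((hmeas i j).comp measurable_fst).sub_const _).mul ((hv j).comp measurable_snd)
    rw [this]
    have hd : Measurable fun p : WG × EuclideanSpace ℝ (Fin n) =>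
        (WithLp.toLp 2 fun i => ∑ j, ((p.1 : Matrix (Fin n) (Fin n) ℝ) i j - Wt i j) * p.2 j :
          EuclideanSpace ℝ (Fin n)) := (WithLp.measurable_toLp 2 (Fin n → ℝ)).comp hc
    exact hd.const_smul c⁻¹
  norm_le w v := by
    have h1 := (Matrix.toEuclideanCLM (𝕜 := ℝ) ((w : Matrix (Fin n) (Fin n) ℝ) - Wt)).le_opNorm v
    have h2 := hρ w w.2
    rw [scaledOp_apply, norm_smul, norm_inv, Real.norm_of_nonneg hc.le, div_mul_eq_mul_div,
      inv_mul_eq_div]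
    gcongr
    exact h1.trans (mul_le_mul_of_nonneg_right h2 (norm_nonneg v))
  integral_eq_zero u v := by
    have e : ∀ w : WG, ⟪u, scaledOp c ((w : Matrix (Fin n) (Fin n) ℝ) - Wt) v⟫ =
        ∑ i, ∑ j, c⁻¹ * (u i * v j) * ((w : Matrix (Fin n) (Fin n) ℝ) i j - Wt i j) := by
      intro w
      rw [scaledOp_apply, real_inner_smul_right, mulVecE, Matrix.inner_toEuclideanCLM]
      simp only [dotProduct, Matrix.mulVec, Finset.mul_sum, Matrix.sub_apply]
      exact Finset.sum_congr rfl fun i _ => Finset.sum_congr rfl fun j _ => by ring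
    have hi : ∀ i j, Integrable (fun w : WG => (w : Matrix (Fin n) (Fin n) ℝ) i j - Wt i j) π :=
      fun i j => integrable_of_measurable_of_abs_le ((hmeas i j).sub_const _) (C := ρ) fun w =>
        (abs_entry_le_spectralNorm2 ((w : Matrix (Fin n) (Fin n) ℝ) - Wt) i j).trans (hρ w w.2)
    have h0 : ∀ i j, ∫ w : WG, ((w : Matrix (Fin n) (Fin n) ℝ) i j - Wt i j) ∂π = 0 := by
      intro i j
      have h2 : Integrable (fun w : WG => (w : Matrix (Fin n) (Fin n) ℝ) i j) π := by
        have := (hi i j).add (integrable_const (Wt i j))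
        refine this.congr (ae_of_all _ fun w => ?_)
        simp
      rw [integral_sub h2 (integrable_const _), hmean]
      simp
    simp only [e]
    rw [integral_finsetSum _ fun i _ => integrable_finsetSum _ fun j _ => (hi i j).const_mul _]
    refine Finset.sum_eq_zero fun i _ => ?_
    rw [integral_finsetSum _ fun j _ => (hi i j).const_mul _]
    refine Finset.sum_eq_zero fun j _ => ?_
    rw [integral_const_mul, h0, mul_zero]

theorem batchAverage_eq {WG : Set (Matrix (Fin n) (Fin n) ℝ)} {Wt : Matrix (Fin n) (Fin n) ℝ}
    {c : ℝ} (hc : c ≠ 0) {xs : EuclideanSpace ℝ (Fin n)} (hxs : ∀ w ∈ WG, mulVecE w xs = 0)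
    (x : ℕ → WG) (T : ℕ) {m : ℕ} (hm : m ≠ 0) (z : EuclideanSpace ℝ (Fin n))
    (y : (ℕ → WG) → EuclideanSpace ℝ (Fin n)) (hy : z - xs = y x) :
    batchAverage (fun k => (x k : Matrix (Fin n) (Fin n) ℝ)) T m z =
      c • (scaledOp c Wt (y x) +
        noiseAverage (fun w : WG => scaledOp c ((w : Matrix (Fin n) (Fin n) ℝ) - Wt)) T m y x) := by
  have hm' : (m : ℝ) ≠ 0 := by exact_mod_cast hm
  have h1 : ∀ k, mulVecE (x k : Matrix (Fin n) (Fin n) ℝ) z =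
      mulVecE Wt (y x) + mulVecE ((x k : Matrix (Fin n) (Fin n) ℝ) - Wt) (y x) := fun k => by
    have hz : z = y x + xs := by rw [← hy]; abel
    have h2 := hxs (x k) (x k).2
    unfold mulVecE at h2 ⊢
    rw [hz, map_add, h2, map_sub, _root_.sub_apply]
    abel
  simp only [batchAverage, noiseAverage, scaledOp_apply, h1, Finset.sum_add_distrib,
    Finset.sum_const, Nat.card_Icc, ← Finset.smul_sum]
  rw [smul_add, smul_add, smul_smul, smul_comm ((m : ℝ)⁻¹) c⁻¹, smul_smul, mul_inv_cancel₀ hc,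
    one_smul, one_smul, Nat.add_sub_cancel, ← Nat.cast_smul_eq_nsmul ℝ, smul_smul,
    inv_mul_cancel₀ hm', one_smul]

/-- Since the gossip matrices vanish at `xs`, the estimator at `z` is the exact gradient at `z - xs`
plus the error of the multilevel estimator. -/
theorem mlmcEstimate_eq {WG : Set (Matrix (Fin n) (Fin n) ℝ)} {Wt : Matrix (Fin n) (Fin n) ℝ}
    {c : ℝ} (hc : c ≠ 0) {xs : EuclideanSpace ℝ (Fin n)} (hxs : ∀ w ∈ WG, mulVecE w xs = 0)
    (x : ℕ → WG) (T : ℕ) {M : ℝ} {K B j : ℕ} (hB : B ≠ 0) (hK : (2 : ℝ) ^ j ≤ M ↔ j ≤ K)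
    (z : EuclideanSpace ℝ (Fin n))
    (y : (ℕ → WG) → EuclideanSpace ℝ (Fin n)) (hy : z - xs = y x) :
    mlmcEstimate M B (fun k => (x k : Matrix (Fin n) (Fin n) ℝ)) T j z =
      c • (scaledOp c Wt (y x) + multilevelError
        (fun w : WG => scaledOp c ((w : Matrix (Fin n) (Fin n) ℝ) - Wt)) K B T y j x) := by
  have hp : ∀ i, 2 ^ i * B ≠ 0 := fun i => mul_ne_zero (by positivity) hB
  rw [mlmcEstimate, multilevelError, batchAverage_eq hc hxs x T hB z y hy,
    batchAverage_eq (Wt := Wt) hc hxs x T (hp j) z y hy,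
    batchAverage_eq (Wt := Wt) hc hxs x T (hp (j - 1)) z y hy]
  simp only [hK]
  split_ifs
  · module
  · simp

end Algorithm

/-! ### The centred iteration along fixed levels -/

section Iteration

open scoped RealInnerProductSpace

variable {S E : Type*} [NormedAddCommGroup E] [InnerProductSpace ℝ E]

/-- The accelerated iteration in coordinates centred at the minimizer and rescaled by the smallest
positive eigenvalue: the pair of iterates after `k` steps, as functions of the trajectory of the
chain, along the levels `j`. -/
noncomputable def centredIterate (F : S → E →L[ℝ] E) (A : E →L[ℝ] E) (β θ : ℝ) (K B : ℕ) (v₀ : E)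
    (j : ℕ → ℕ) : ℕ → ((ℕ → S) → E) × ((ℕ → S) → E)
  | 0 => (fun _ => v₀, fun _ => v₀)
  | k + 1 =>
    let s := centredIterate F A β θ K B v₀ j k
    let y := fun x => θ • s.2 x + (1 - θ) • s.1 x
    let g := fun x =>
      A (y x) + multilevelError F K B (∑ i ∈ Finset.range k, 2 ^ j i * B) y (j k) x
    (fun x => y x + (1 - β) • (s.1 x - y x) - (3 * β) • g x, fun x => y x - (3 * β ^ 2) • g x)

/-- The point at which the gradient is evaluated in the step after `k` iterations. -/
noncomputable def centredPoint (F : S → E →L[ℝ] E) (A : E →L[ℝ] E) (β θ : ℝ) (K B : ℕ) (v₀ : E)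
    (j : ℕ → ℕ) (k : ℕ) (x : ℕ → S) : E :=
  θ • (centredIterate F A β θ K B v₀ j k).2 x + (1 - θ) • (centredIterate F A β θ K B v₀ j k).1 x

variable {F : S → E →L[ℝ] E} {A : E →L[ℝ] E} {β θ : ℝ} {K B : ℕ} {v₀ : E} {ρ : ℝ}

theorem centredIterate_congr {j j' : ℕ → ℕ} {k : ℕ} (h : ∀ i < k, j i = j' i) :
    centredIterate F A β θ K B v₀ j k = centredIterate F A β θ K B v₀ j' k := by
  induction k with
  | zero => rfl
  | succ k ih =>
    have h1 := ih fun i hi => h i (by omega)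
    have h2 : ∑ i ∈ Finset.range k, 2 ^ j i * B = ∑ i ∈ Finset.range k, 2 ^ j' i * B :=
      Finset.sum_congr rfl fun i hi => by
        rw [h i (by have := Finset.mem_range.1 hi; omega)]
    simp only [centredIterate, h1, h2, h k (Nat.lt_succ_self k)]

/-- The step after `k` iterations with the level `l`, as a gradient step followed by the
perturbation due to the error of the estimator. -/
theorem centredIterate_update_succ (j : ℕ → ℕ) (k l : ℕ) :
    centredIterate F A β θ K B v₀ (Function.update j k l) (k + 1) =
      (fun x => centredPoint F A β θ K B v₀ j k x +
          (1 - β) • ((centredIterate F A β θ K B v₀ j k).1 x - centredPoint F A β θ K B v₀ j k x) -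
          (3 * β) • A (centredPoint F A β θ K B v₀ j k x) -
          (3 * β) • multilevelError F K B (∑ i ∈ Finset.range k, 2 ^ j i * B)
            (centredPoint F A β θ K B v₀ j k) l x,
        fun x => centredPoint F A β θ K B v₀ j k x -
          (3 * β ^ 2) • A (centredPoint F A β θ K B v₀ j k x) -
          (3 * β ^ 2) • multilevelError F K B (∑ i ∈ Finset.range k, 2 ^ j i * B)
            (centredPoint F A β θ K B v₀ j k) l x) := by
  have h1 : centredIterate F A β θ K B v₀ (Function.update j k l) k =
      centredIterate F A β θ K B v₀ j k :=
    centredIterate_congr fun i hi => Function.update_of_ne (by omega) _ _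
  have h2 : ∑ i ∈ Finset.range k, 2 ^ Function.update j k l i * B =
      ∑ i ∈ Finset.range k, 2 ^ j i * B := Finset.sum_congr rfl fun i hi => by
    rw [Function.update_of_ne (by have := Finset.mem_range.1 hi; omega)]
  simp only [centredIterate, h1, h2, Function.update_self, smul_add]
  refine Prod.ext (funext fun x => ?_) (funext fun x => ?_) <;>
  · simp only [centredPoint]
    abel

theorem centredIterate_succ (j : ℕ → ℕ) (k : ℕ) :
    centredIterate F A β θ K B v₀ j (k + 1) =
      (fun x => centredPoint F A β θ K B v₀ j k x +
          (1 - β) • ((centredIterate F A β θ K B v₀ j k).1 x - centredPoint F A β θ K B v₀ j k x) -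
          (3 * β) • A (centredPoint F A β θ K B v₀ j k x) -
          (3 * β) • multilevelError F K B (∑ i ∈ Finset.range k, 2 ^ j i * B)
            (centredPoint F A β θ K B v₀ j k) (j k) x,
        fun x => centredPoint F A β θ K B v₀ j k x -
          (3 * β ^ 2) • A (centredPoint F A β θ K B v₀ j k x) -
          (3 * β ^ 2) • multilevelError F K B (∑ i ∈ Finset.range k, 2 ^ j i * B)
            (centredPoint F A β θ K B v₀ j k) (j k) x) := by
  rw [← centredIterate_update_succ, Function.update_eq_self]

/-- Level `0` and the levels above `K` all amount to the plain batch average. -/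
theorem multilevelError_of_notMem {l : ℕ} (hl : l ∉ Finset.Icc 1 K) (t : ℕ) (y : (ℕ → S) → E) :
    multilevelError F K B t y l = multilevelError F K B t y (K + 1) := by
  funext x
  have h : l = 0 ∨ K < l := by
    rw [Finset.mem_Icc] at hl; omega
  rcases h with rfl | h
  · simp [multilevelError]
  · simp [multilevelError, h]

theorem multilevelError_mem {V : Submodule ℝ E} (hFV : ∀ w v, F w v ∈ V) (t : ℕ)
    (y : (ℕ → S) → E) (l : ℕ) (x : ℕ → S) : multilevelError F K B t y l x ∈ V := by
  have h : ∀ m, noiseAverage F t m y x ∈ V := fun m =>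
    V.smul_mem _ (V.sum_mem fun i _ => hFV _ _)
  refine V.add_mem (h _) ?_
  split_ifs
  · exact V.smul_mem _ (V.sub_mem (h _) (h _))
  · exact V.zero_mem

theorem centredIterate_mem {V : Submodule ℝ E} (hFV : ∀ w v, F w v ∈ V) (hAV : ∀ v, A v ∈ V)
    (hv₀ : v₀ ∈ V) (j : ℕ → ℕ) (k : ℕ) (x : ℕ → S) :
    (centredIterate F A β θ K B v₀ j k).1 x ∈ V ∧ (centredIterate F A β θ K B v₀ j k).2 x ∈ V := by
  induction k with
  | zero => exact ⟨hv₀, hv₀⟩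
  | succ k ih =>
    have hy : centredPoint F A β θ K B v₀ j k x ∈ V :=
      V.add_mem (V.smul_mem _ ih.2) (V.smul_mem _ ih.1)
    have hξ := multilevelError_mem (K := K) (B := B) hFV (∑ i ∈ Finset.range k, 2 ^ j i * B)
      (centredPoint F A β θ K B v₀ j k) (j k) x
    rw [centredIterate_succ]
    exact ⟨V.sub_mem (V.sub_mem (V.add_mem hy (V.smul_mem _ (V.sub_mem ih.1 hy)))
        (V.smul_mem _ (hAV _))) (V.smul_mem _ hξ),
      V.sub_mem (V.sub_mem hy (V.smul_mem _ (hAV _))) (V.smul_mem _ hξ)⟩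

theorem norm_noiseAverage_le (hF : ∀ w v, ‖F w v‖ ≤ ρ * ‖v‖) (hρ : 0 ≤ ρ) (t m : ℕ)
    (y : (ℕ → S) → E) (x : ℕ → S) : ‖noiseAverage F t m y x‖ ≤ ρ * ‖y x‖ := by
  have h : ‖∑ i ∈ Finset.Icc 1 m, F (x (t + i)) (y x)‖ ≤ m * (ρ * ‖y x‖) :=
    (norm_sum_le_of_le _ fun i _ => hF _ _).trans (le_of_eq (by simp))
  rcases Nat.eq_zero_or_pos m with rfl | hm
  · simp only [noiseAverage, Nat.cast_zero, inv_zero, zero_smul, norm_zero]; positivity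
  · have hm' : (0 : ℝ) < m := by exact_mod_cast hm
    rw [noiseAverage, norm_smul, norm_inv, Real.norm_natCast, inv_mul_le_iff₀ hm']
    exact h

theorem norm_multilevelError_le (hF : ∀ w v, ‖F w v‖ ≤ ρ * ‖v‖) (hρ : 0 ≤ ρ) (t : ℕ)
    (y : (ℕ → S) → E) (l : ℕ) (x : ℕ → S) :
    ‖multilevelError F K B t y l x‖ ≤ ρ * (1 + 2 ^ K * 2) * ‖y x‖ := by
  have h : ∀ m, ‖noiseAverage F t m y x‖ ≤ ρ * ‖y x‖ := fun m => norm_noiseAverage_le hF hρ t m y x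
  have h0 : 0 ≤ ρ * ‖y x‖ := by positivity
  rw [multilevelError]
  refine (norm_add_le _ _).trans ?_
  have h2 : ‖if l ≤ K then (2 : ℝ) ^ l • (noiseAverage F t (2 ^ l * B) y x -
      noiseAverage F t (2 ^ (l - 1) * B) y x) else 0‖ ≤ 2 ^ K * (2 * (ρ * ‖y x‖)) := by
    split_ifs with hl
    · rw [norm_smul, Real.norm_of_nonneg (by positivity)]
      have h3 := (norm_sub_le _ _).trans
        (add_le_add (h (2 ^ l * B)) (h (2 ^ (l - 1) * B)))
      have h4 : (2 : ℝ) ^ l ≤ 2 ^ K := pow_le_pow_right₀ (by norm_num) hl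
      exact mul_le_mul h4 (h3.trans (le_of_eq (by ring))) (norm_nonneg _) (by positivity)
    · rw [norm_zero]; positivity
  linarith [h B]

/-- The iterates after `k` steps are bounded uniformly in the trajectory and in the levels. -/
theorem exists_norm_centredIterate_le (hF : ∀ w v, ‖F w v‖ ≤ ρ * ‖v‖) (hρ : 0 ≤ ρ) (k : ℕ) :
    ∃ C : ℝ, ∀ (j : ℕ → ℕ) (x : ℕ → S), ‖(centredIterate F A β θ K B v₀ j k).1 x‖ ≤ C ∧
      ‖(centredIterate F A β θ K B v₀ j k).2 x‖ ≤ C := by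
  induction k with
  | zero => exact ⟨‖v₀‖, fun j x => ⟨le_rfl, le_rfl⟩⟩
  | succ k ih =>
    obtain ⟨C, hC⟩ := ih
    set Y := (|θ| + |1 - θ|) * C with hY
    refine ⟨(Y + |1 - β| * (C + Y) + |3 * β| * (‖A‖ * Y) +
        |3 * β| * (ρ * (1 + 2 ^ K * 2) * Y)) +
      (Y + |3 * β ^ 2| * (‖A‖ * Y) + |3 * β ^ 2| * (ρ * (1 + 2 ^ K * 2) * Y)), fun j x => ?_⟩
    obtain ⟨h1, h2⟩ := hC j x
    have hC0 : 0 ≤ C := (norm_nonneg _).trans h1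
    have hY0 : 0 ≤ Y := by positivity
    rw [centredIterate_succ]
    set v := (centredIterate F A β θ K B v₀ j k).1 x
    have hy : ‖centredPoint F A β θ K B v₀ j k x‖ ≤ Y := by
      refine (norm_add_le _ _).trans ?_
      rw [norm_smul, norm_smul, hY, add_mul]
      exact add_le_add (mul_le_mul_of_nonneg_left h2 (norm_nonneg _))
        (mul_le_mul_of_nonneg_left h1 (norm_nonneg _))
    have hξ := norm_multilevelError_le (K := K) (B := B) hF hρ
      (∑ i ∈ Finset.range k, 2 ^ j i * B) (centredPoint F A β θ K B v₀ j k) (j k) x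
    set y := centredPoint F A β θ K B v₀ j k x
    set ξ := multilevelError F K B (∑ i ∈ Finset.range k, 2 ^ j i * B)
      (centredPoint F A β θ K B v₀ j k) (j k) x
    have hξ' : ‖ξ‖ ≤ ρ * (1 + 2 ^ K * 2) * Y :=
      hξ.trans (mul_le_mul_of_nonneg_left hy (by positivity))
    have hA' : ‖A y‖ ≤ ‖A‖ * Y :=
      (A.le_opNorm _).trans (mul_le_mul_of_nonneg_left hy (norm_nonneg _))
    have n1 : ‖y + (1 - β) • (v - y) - (3 * β) • A y - (3 * β) • ξ‖ ≤
        Y + |1 - β| * (C + Y) + |3 * β| * (‖A‖ * Y) + |3 * β| * (ρ * (1 + 2 ^ K * 2) * Y) := by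
      refine (norm_sub_le _ _).trans (add_le_add ((norm_sub_le _ _).trans
        (add_le_add ((norm_add_le _ _).trans (add_le_add hy ?_)) ?_)) ?_) <;>
      rw [norm_smul, Real.norm_eq_abs]
      · exact mul_le_mul_of_nonneg_left ((norm_sub_le _ _).trans (add_le_add h1 hy))
          (abs_nonneg _)
      · exact mul_le_mul_of_nonneg_left hA' (abs_nonneg _)
      · exact mul_le_mul_of_nonneg_left hξ' (abs_nonneg _)
    have n2 : ‖y - (3 * β ^ 2) • A y - (3 * β ^ 2) • ξ‖ ≤
        Y + |3 * β ^ 2| * (‖A‖ * Y) + |3 * β ^ 2| * (ρ * (1 + 2 ^ K * 2) * Y) := by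
      refine (norm_sub_le _ _).trans (add_le_add ((norm_sub_le _ _).trans
        (add_le_add hy ?_)) ?_) <;> rw [norm_smul, Real.norm_eq_abs]
      · exact mul_le_mul_of_nonneg_left hA' (abs_nonneg _)
      · exact mul_le_mul_of_nonneg_left hξ' (abs_nonneg _)
    exact ⟨n1.trans (le_add_of_nonneg_right (by positivity)),
      n2.trans (le_add_of_nonneg_left (by positivity))⟩

variable [MeasurableSpace S] [MeasurableSpace E] [BorelSpace E] [SecondCountableTopology E]
  {π : Measure S}

/-- Along fixed levels the iterates depend on the matrices already used only. -/
theorem IsCenteredNoise.isBoundedAdapted_centredIterate (hF : IsCenteredNoise F π ρ) (hρ : 0 ≤ ρ)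
    (j : ℕ → ℕ) (k : ℕ) :
    IsBoundedAdapted (∑ i ∈ Finset.range k, 2 ^ j i * B) (centredIterate F A β θ K B v₀ j k).1 ∧
    IsBoundedAdapted (∑ i ∈ Finset.range k, 2 ^ j i * B)
      (centredIterate F A β θ K B v₀ j k).2 := by
  induction k with
  | zero =>
    have : IsBoundedAdapted (S := S) (∑ i ∈ Finset.range 0, 2 ^ j i * B) fun _ => v₀ :=
      ⟨measurable_const, ⟨‖v₀‖, fun _ => le_rfl⟩, fun _ _ _ => rfl⟩
    exact ⟨this, this⟩
  | succ k ih =>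
    have hy : IsBoundedAdapted (∑ i ∈ Finset.range k, 2 ^ j i * B)
        (centredPoint F A β θ K B v₀ j k) := (ih.2.smul _).add (ih.1.smul _)
    have hξ := hF.isBoundedAdapted_multilevelError hρ hy K B (j k)
    rw [centredIterate_succ, Finset.sum_range_succ]
    have hm : ∑ i ∈ Finset.range k, 2 ^ j i * B ≤
      ∑ i ∈ Finset.range k, 2 ^ j i * B + 2 ^ j k * B := Nat.le_add_right _ _
    exact ⟨((((hy.add ((ih.1.sub hy).smul _)).sub ((hy.clm A).smul _)).mono hm).sub (hξ.smul _)),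
      ((hy.sub ((hy.clm A).smul _)).mono hm).sub (hξ.smul _)⟩

/-- Jointly in the trajectory and the levels, the iterates are measurable: they depend on finitely
many levels only, and these take countably many values. -/
theorem IsCenteredNoise.measurable_centredIterate (hF : IsCenteredNoise F π ρ) (hρ : 0 ≤ ρ)
    (k : ℕ) :
    Measurable (fun p : (ℕ → S) × (ℕ → ℕ) => (centredIterate F A β θ K B v₀ p.2 k).1 p.1) ∧
    Measurable (fun p : (ℕ → S) × (ℕ → ℕ) => (centredIterate F A β θ K B v₀ p.2 k).2 p.1) := by
  let ext : (Fin k → ℕ) → ℕ → ℕ := fun h i => if hi : i < k then h ⟨i, hi⟩ else 0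
  have hext : ∀ j : ℕ → ℕ, centredIterate F A β θ K B v₀ j k =
      centredIterate F A β θ K B v₀ (ext fun i => j i) k := fun j =>
    centredIterate_congr fun i hi => by simp [ext, hi]
  have hr : Measurable fun p : (ℕ → S) × (ℕ → ℕ) => (p.1, fun i : Fin k => p.2 i) :=
    measurable_fst.prodMk (measurable_pi_lambda _ fun i =>
      (measurable_pi_apply (i : ℕ)).comp measurable_snd)
  have h := fun j => hF.isBoundedAdapted_centredIterate (A := A) (β := β) (θ := θ) (K := K)
    (B := B) (v₀ := v₀) hρ j k
  have g1 : Measurable fun p : (ℕ → S) × (Fin k → ℕ) =>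
      (centredIterate F A β θ K B v₀ (ext p.2) k).1 p.1 :=
    measurable_from_prod_countable_left fun q => (h (ext q)).1.measurable
  have g2 : Measurable fun p : (ℕ → S) × (Fin k → ℕ) =>
      (centredIterate F A β θ K B v₀ (ext p.2) k).2 p.1 :=
    measurable_from_prod_countable_left fun q => (h (ext q)).2.measurable
  constructor
  · convert g1.comp hr using 2 with p
    rw [hext]; rfl
  · convert g2.comp hr using 2 with p
    rw [hext]; rfl

variable {Ω : Type*} [MeasurableSpace Ω] {X : ℕ → Ω → S} {Q : Kernel S S} [IsMarkovKernel Q]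
  {μ : Measure Ω} [IsProbabilityMeasure μ] {τ : ℕ}

/-- One iteration contracts the Lyapunov function by `1 - β / 2`, on average over the chain and the
level of that iteration, for any fixed levels of the iterations before. -/
theorem IsCenteredNoise.levelMean_integral_centredIterate_le (hF : IsCenteredNoise F π ρ)
    (hρ : 0 ≤ ρ) (hX : IsStationaryMarkovChain X Q π μ)
    (hQ : IsUniformlyGeometricallyErgodic Q τ) (hτ : 1 ≤ τ)
    (hA : ∀ v w, ⟪A v, w⟫ = ⟪v, A w⟫) (hβ0 : 0 ≤ β) (hβ : β ≤ 1 / 4)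
    (hA0 : ∀ v, 0 ≤ ⟪v, A v⟫)
    (hAβ : ∀ v, 16 * β ^ 2 * ⟪v, A v⟫ ≤ ‖v‖ ^ 2) (hAn : ∀ v, 16 * β ^ 2 * ‖A v‖ ≤ ‖v‖)
    (hθ : θ * (4 - β ^ 2) = 4 - β) {V : Submodule ℝ E} (hFV : ∀ w v, F w v ∈ V)
    (hAV : ∀ v, A v ∈ V) (hv₀ : v₀ ∈ V) (hV : ∀ v ∈ V, ‖v‖ ^ 2 ≤ ⟪v, A v⟫) (hB : B ≠ 0)
    (hκ : 8 / 3 * τ * ρ / ((2 : ℝ) ^ K * B) ≤ 1 / 10)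
    (hσ : β * (19 / 3 * τ * ρ ^ 2 * (2 + 12 * K) / B) ≤ 1 / 60) (j : ℕ → ℕ) (k : ℕ) :
    levelMean K (fun l => ∫ x, lyapunov A
        ((centredIterate F A β θ K B v₀ (Function.update j k l) (k + 1)).1 x)
        ((centredIterate F A β θ K B v₀ (Function.update j k l) (k + 1)).2 x) ∂pathLaw X μ) ≤
      (1 - β / 2) * ∫ x, lyapunov A ((centredIterate F A β θ K B v₀ j k).1 x)
        ((centredIterate F A β θ K B v₀ j k).2 x) ∂pathLaw X μ := by
  have := hX.isProbabilityMeasure_pathLaw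
  obtain ⟨hv, hvf⟩ := hF.isBoundedAdapted_centredIterate (A := A) (β := β) (θ := θ) (K := K)
    (B := B) (v₀ := v₀) hρ j k
  have hy : IsBoundedAdapted (∑ i ∈ Finset.range k, 2 ^ j i * B)
    (centredPoint F A β θ K B v₀ j k) := (hvf.smul _).add (hv.smul _)
  have hu1 := (hy.add ((hv.sub hy).smul (1 - β))).sub ((hy.clm A).smul (3 * β))
  have hu2 := hy.sub ((hy.clm A).smul (3 * β ^ 2))
  have hl := ((hu1.smul (6 * β + 6 * β ^ 2)).add (hu2.smul (6 * β))).add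
    ((hu2.clm A).smul (72 * β ^ 2))
  have h1 := hF.levelMean_integral_lyapunov_le hρ hX hQ hτ hA hβ0 hβ hAβ hu1 hu2 hy K hB
  simp only [centredIterate_update_succ]
  refine h1.trans ?_
  rw [← integral_const_mul]
  refine integral_mono ((((hu1.lyapunov A hu2).add ((hl.norm.mul hy.norm).const_mul _)).add
    (hy.norm_sq.const_mul _)).integrable _) (((hv.lyapunov A hvf).integrable _).const_mul _)
    fun x => ?_
  have hmem := centredIterate_mem (β := β) (θ := θ) (K := K) (B := B) hFV hAV hv₀ j k x
  have hyV : centredPoint F A β θ K B v₀ j k x ∈ V :=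
    V.add_mem (V.smul_mem _ hmem.2) (V.smul_mem _ hmem.1)
  have h4 : (4 - β) ≠ 0 := by linarith
  have hε : β * (1 - β) / (4 - β) * (4 - β) = β * (1 - β) := div_mul_cancel₀ _ h4
  have h2 := lyapunov_step_le hA hβ0 hβ hA0 hAβ hAn hε (centredPoint F A β θ K B v₀ j k x)
    ((centredIterate F A β θ K B v₀ j k).1 x - centredPoint F A β θ K B v₀ j k x) (hV _ hyV)
  -- the extrapolation weight `θ` makes `x_f` an affine combination of `x_g` and `x`
  have e2 : centredPoint F A β θ K B v₀ j k x - (β * (1 - β) / (4 - β)) •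
      ((centredIterate F A β θ K B v₀ j k).1 x - centredPoint F A β θ K B v₀ j k x) =
      (centredIterate F A β θ K B v₀ j k).2 x := by
    have h5 : (4 - β ^ 2) ≠ 0 := by nlinarith
    have hθ' : θ = (4 - β) / (4 - β ^ 2) := by rw [← hθ]; field_simp
    have c1 : θ + β * (1 - β) / (4 - β) * θ = 1 := by rw [hθ']; field_simp; ring
    have c2 : (1 - θ) - β * (1 - β) / (4 - β) * θ = 0 := by linear_combination -c1
    simp only [centredPoint]
    rw [show ∀ a b : E, θ • a + (1 - θ) • b - (β * (1 - β) / (4 - β)) •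
      (b - (θ • a + (1 - θ) • b)) = (θ + β * (1 - β) / (4 - β) * θ) • a +
      ((1 - θ) - β * (1 - β) / (4 - β) * θ) • b from fun a b => by module, c1, c2]
    simp
  rw [add_sub_cancel, e2] at h2
  refine le_trans ?_ h2
  have k1 := mul_le_mul_of_nonneg_right hκ (mul_nonneg (norm_nonneg (errorDirection A β
    (centredPoint F A β θ K B v₀ j k x + (1 - β) • ((centredIterate F A β θ K B v₀ j k).1 x -
      centredPoint F A β θ K B v₀ j k x) - (3 * β) • A (centredPoint F A β θ K B v₀ j k x))
    (centredPoint F A β θ K B v₀ j k x -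
      (3 * β ^ 2) • A (centredPoint F A β θ K B v₀ j k x))))
    (norm_nonneg (centredPoint F A β θ K B v₀ j k x)))
  have k2 := mul_le_mul_of_nonneg_right hσ
    (mul_nonneg hβ0 (sq_nonneg ‖centredPoint F A β θ K B v₀ j k x‖))
  refine add_le_add (add_le_add le_rfl k1) ?_
  linarith

end Iteration

/-! ### Averaging over the levels -/

section RandomLevels

variable {Ω : Type*} [MeasurableSpace Ω] {μ : Measure Ω} [IsProbabilityMeasure μ] {J : ℕ → Ω → ℕ}

/-- The mean over the levels as a finite sum of corrections to the value above the largest level. -/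
theorem levelMean_eq_add_sum (K : ℕ) (f : ℕ → ℝ) :
    levelMean K f = f (K + 1) + ∑ l ∈ Finset.Icc 1 K, (1 / 2 : ℝ) ^ l * (f l - f (K + 1)) := by
  have h1 : levelMean K f = levelMean K fun l => f (K + 1) + (f l - f (K + 1)) := by
    simp only [add_sub_cancel]
  rw [h1, levelMean_add, levelMean_const, levelMean, sub_self, mul_zero, add_zero]

/-- Integrating out a level that is independent of the preceding ones. The values outside `1, …, K`,
among them the level `0` of probability zero, are all treated alike by `H`. -/
theorem integral_eq_integral_levelMean (hJm : ∀ k, Measurable (J k))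
    (hJ : ∀ k j, 1 ≤ j → μ {ω | J k ω = j} = (1 / 2 : ℝ≥0∞) ^ j) (hind : iIndepFun J μ)
    {k K : ℕ} {H : (ℕ → ℕ) → ℕ → ℝ} {C : ℝ} (hC : ∀ j l, |H j l| ≤ C)
    (hdep : DependsOn H (Set.Iio k))
    (hK : ∀ j, ∀ l ∉ Finset.Icc 1 K, H j l = H j (K + 1)) :
    ∫ ω, H (fun i => J i ω) (J k ω) ∂μ = ∫ ω, levelMean K (H fun i => J i ω) ∂μ := by
  classical
  let ext : (Finset.range k → ℕ) → ℕ → ℕ := fun h i =>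
    if hi : i ∈ Finset.range k then h ⟨i, hi⟩ else 0
  have hext : ∀ j : ℕ → ℕ, H j = H (ext fun i => j i) := fun j =>
    hdep fun i hi => by simp [ext, Set.mem_Iio.1 hi]
  have hpre : Measurable fun ω (i : Finset.range k) => J i ω :=
    measurable_pi_lambda _ fun i => hJm i
  have hm : ∀ l, Measurable fun ω => H (fun i => J i ω) l := fun l => by
    have h1 : Measurable fun h : Finset.range k → ℕ => H (ext h) l := measurable_of_countable _
    have h2 : (fun ω => H (fun i => J i ω) l) =
        (fun h : Finset.range k → ℕ => H (ext h) l) ∘ fun ω (i : Finset.range k) => J i ω := by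
      funext ω
      rw [hext]; rfl
    rw [h2]
    exact h1.comp hpre
  have hi : ∀ l, Integrable (fun ω => H (fun i => J i ω) l) μ := fun l =>
    integrable_of_measurable_of_abs_le (hm l) fun ω => hC _ l
  have hid : Integrable (fun ω => H (fun i => J i ω) (K + 1)) μ := hi _
  have hdiff : ∀ l, Integrable (fun ω => H (fun i => J i ω) l - H (fun i => J i ω) (K + 1)) μ :=
    fun l => (hi l).sub (hi _)
  have hind1 : ∀ l : ℕ, Measurable fun ω => if J k ω = l then (1 : ℝ) else 0 := fun l =>
    Measurable.ite (hJm k (measurableSet_singleton l)) measurable_const measurable_const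
  have hprod : ∀ l, Integrable (fun ω => (if J k ω = l then (1 : ℝ) else 0) *
      (H (fun i => J i ω) l - H (fun i => J i ω) (K + 1))) μ := fun l =>
    integrable_of_measurable_of_abs_le (C := C + C) ((hind1 l).mul ((hm l).sub (hm _)))
      fun ω => by
        have h1 := (abs_sub _ _).trans (add_le_add (hC (fun i => J i ω) l)
          (hC (fun i => J i ω) (K + 1)))
        split_ifs
        · simpa using h1
        · simpa using (abs_nonneg _).trans h1
  have e1 : ∀ ω, H (fun i => J i ω) (J k ω) = H (fun i => J i ω) (K + 1) +
      ∑ l ∈ Finset.Icc 1 K, (if J k ω = l then (1 : ℝ) else 0) *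
        (H (fun i => J i ω) l - H (fun i => J i ω) (K + 1)) := fun ω => by
    simp only [ite_mul, one_mul, zero_mul, Finset.sum_ite_eq]
    split_ifs with h
    · ring
    · rw [add_zero, hK _ _ h]
  have e2 : ∀ l ∈ Finset.Icc 1 K, ∫ ω, (if J k ω = l then (1 : ℝ) else 0) *
      (H (fun i => J i ω) l - H (fun i => J i ω) (K + 1)) ∂μ =
      ∫ ω, (1 / 2 : ℝ) ^ l * (H (fun i => J i ω) l - H (fun i => J i ω) (K + 1)) ∂μ := by
    intro l hl
    have h0 : IndepFun (J k) (fun ω (i : Finset.range k) => J i ω) μ := by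
      have h1 := hind.indepFun_finset {k} (Finset.range k) (by simp) hJm
      exact h1.comp (φ := fun f : ({k} : Finset ℕ) → ℕ => f ⟨k, Finset.mem_singleton_self k⟩)
        (ψ := id) (measurable_of_countable _) measurable_id
    have h2 : IndepFun (fun ω => if J k ω = l then (1 : ℝ) else 0)
        (fun ω => H (fun i => J i ω) l - H (fun i => J i ω) (K + 1)) μ := by
      have h3 := h0.comp (φ := fun i => if i = l then (1 : ℝ) else 0)
        (ψ := fun h => H (ext h) l - H (ext h) (K + 1))
        (measurable_of_countable _) (measurable_of_countable _)
      have h4 : (fun ω => H (fun i => J i ω) l - H (fun i => J i ω) (K + 1)) =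
          (fun h => H (ext h) l - H (ext h) (K + 1)) ∘
            fun ω (i : Finset.range k) => J i ω := by
        funext ω
        rw [hext]; rfl
      rw [h4]
      exact h3
    have h4 : ∫ ω, (if J k ω = l then (1 : ℝ) else 0) ∂μ = (1 / 2) ^ l := by
      have h5 : (fun ω => if J k ω = l then (1 : ℝ) else 0) =
          Set.indicator {ω | J k ω = l} fun _ => 1 := by
        funext ω; simp [Set.indicator_apply]
      have h6 : MeasurableSet {ω | J k ω = l} := hJm k (measurableSet_singleton l)
      rw [h5, integral_indicator_const _ h6, measureReal_def,
        hJ k l (Finset.mem_Icc.1 hl).1]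
      simp
    rw [h2.integral_fun_mul_eq_mul_integral (hind1 l).aestronglyMeasurable
      ((hm l).sub (hm _)).aestronglyMeasurable, h4, integral_const_mul]
  simp only [e1, levelMean_eq_add_sum]
  rw [integral_add hid (integrable_finsetSum _ fun l _ => hprod l),
    integral_add hid (integrable_finsetSum _ fun l _ => (hdiff l).const_mul _),
    integral_finsetSum _ fun l _ => hprod l,
    integral_finsetSum _ fun l _ => (hdiff l).const_mul _, Finset.sum_congr rfl e2]

end RandomLevels

/-! ### Contraction in expectation -/

section Contraction

open scoped RealInnerProductSpace

theorem abs_lyapunov_le {E : Type*} [NormedAddCommGroup E] [InnerProductSpace ℝ E]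
    {A : E →L[ℝ] E} {v w : E} {C : ℝ} (hv : ‖v‖ ≤ C) (hw : ‖w‖ ≤ C) :
    |lyapunov A v w| ≤ C ^ 2 + 2 * (C * C) + 12 * (C * (‖A‖ * C)) := by
  have hC : 0 ≤ C := (norm_nonneg _).trans hv
  unfold lyapunov
  refine (abs_add_three _ _ _).trans (add_le_add (add_le_add ?_ ?_) ?_)
  · rw [abs_of_nonneg (by positivity)]; gcongr
  · rw [abs_mul, abs_two]
    gcongr
    exact (abs_real_inner_le_norm _ _).trans (by gcongr)
  · rw [abs_mul, abs_of_nonneg (by norm_num : (0 : ℝ) ≤ 12)]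
    gcongr
    refine (abs_real_inner_le_norm _ _).trans ?_
    gcongr
    exact (A.le_opNorm w).trans (by gcongr)

variable {S E : Type*} [MeasurableSpace S] [NormedAddCommGroup E] [InnerProductSpace ℝ E]
  [MeasurableSpace E] [BorelSpace E] [SecondCountableTopology E]
  {F : S → E →L[ℝ] E} {A : E →L[ℝ] E} {β θ : ℝ} {K B : ℕ} {v₀ : E} {ρ : ℝ}
  {π : Measure S} {Ω : Type*} [MeasurableSpace Ω] {X : ℕ → Ω → S} {Q : Kernel S S}
  [IsMarkovKernel Q] {μ : Measure Ω} [IsProbabilityMeasure μ] {τ : ℕ} {J : ℕ → Ω → ℕ}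

/-- With the chain and the levels independent, the chain can be integrated out first, with the
levels held fixed. -/
theorem integral_path_levels_eq (hX : Measurable fun ω k => X k ω) (hJm : ∀ k, Measurable (J k))
    (hind : IndepFun (fun ω k => X k ω) (fun ω k => J k ω) μ)
    {G : (ℕ → S) × (ℕ → ℕ) → ℝ} (hG : Measurable G) {C : ℝ} (hC : ∀ p, |G p| ≤ C) :
    ∫ ω, G (fun k => X k ω, fun k => J k ω) ∂μ =
      ∫ ω, ∫ x, G (x, fun k => J k ω) ∂pathLaw X μ ∂μ := by
  have hJ' : Measurable fun ω k => J k ω := measurable_pi_lambda _ hJm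
  have h1 := (indepFun_iff_map_prod_eq_prod_map_map hX.aemeasurable hJ'.aemeasurable).1 hind
  have : IsProbabilityMeasure (pathLaw X μ) := Measure.isProbabilityMeasure_map hX.aemeasurable
  have : IsProbabilityMeasure (μ.map fun ω k => J k ω) :=
    Measure.isProbabilityMeasure_map hJ'.aemeasurable
  have h2 : ∫ ω, G (fun k => X k ω, fun k => J k ω) ∂μ =
      ∫ p, G p ∂(pathLaw X μ).prod (μ.map fun ω k => J k ω) := by
    rw [pathLaw, ← h1, integral_map (hX.prodMk hJ').aemeasurable hG.aestronglyMeasurable]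
  rw [h2, integral_prod_symm _ (integrable_of_measurable_of_abs_le hG hC),
    integral_map hJ'.aemeasurable]
  exact (hG.stronglyMeasurable.integral_prod_left').aestronglyMeasurable

/-- The expected Lyapunov function decays geometrically: by induction, the chain is integrated out
along fixed levels, and then the last level. -/
theorem IsCenteredNoise.integral_lyapunov_centredIterate_le (hF : IsCenteredNoise F π ρ)
    (hρ : 0 ≤ ρ) (hX : IsStationaryMarkovChain X Q π μ)
    (hQ : IsUniformlyGeometricallyErgodic Q τ) (hτ : 1 ≤ τ)
    (hA : ∀ v w, ⟪A v, w⟫ = ⟪v, A w⟫) (hβ0 : 0 ≤ β) (hβ : β ≤ 1 / 4)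
    (hA0 : ∀ v, 0 ≤ ⟪v, A v⟫)
    (hAβ : ∀ v, 16 * β ^ 2 * ⟪v, A v⟫ ≤ ‖v‖ ^ 2) (hAn : ∀ v, 16 * β ^ 2 * ‖A v‖ ≤ ‖v‖)
    (hθ : θ * (4 - β ^ 2) = 4 - β) {V : Submodule ℝ E} (hFV : ∀ w v, F w v ∈ V)
    (hAV : ∀ v, A v ∈ V) (hv₀ : v₀ ∈ V) (hV : ∀ v ∈ V, ‖v‖ ^ 2 ≤ ⟪v, A v⟫) (hB : B ≠ 0)
    (hκ : 8 / 3 * τ * ρ / ((2 : ℝ) ^ K * B) ≤ 1 / 10)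
    (hσ : β * (19 / 3 * τ * ρ ^ 2 * (2 + 12 * K) / B) ≤ 1 / 60)
    (hJm : ∀ k, Measurable (J k))
    (hJ : ∀ k j, 1 ≤ j → μ {ω | J k ω = j} = (1 / 2 : ℝ≥0∞) ^ j) (hind : iIndepFun J μ)
    (hXJ : IndepFun (fun ω k => X k ω) (fun ω k => J k ω) μ) (N : ℕ) :
    ∫ ω, lyapunov A
        ((centredIterate F A β θ K B v₀ (fun k => J k ω) N).1 fun k => X k ω)
        ((centredIterate F A β θ K B v₀ (fun k => J k ω) N).2 fun k => X k ω) ∂μ ≤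
      (1 - β / 2) ^ N * lyapunov A v₀ v₀ := by
  have := hX.isProbabilityMeasure_pathLaw
  set G : ℕ → (ℕ → ℕ) → ℝ := fun k j => ∫ x, lyapunov A
    ((centredIterate F A β θ K B v₀ j k).1 x)
    ((centredIterate F A β θ K B v₀ j k).2 x) ∂pathLaw X μ with hG
  have hbound : ∀ k, ∃ C, ∀ (j : ℕ → ℕ) (x : ℕ → S), |lyapunov A
      ((centredIterate F A β θ K B v₀ j k).1 x)
      ((centredIterate F A β θ K B v₀ j k).2 x)| ≤ C := fun k => by
    obtain ⟨C, hC⟩ := exists_norm_centredIterate_le (A := A) (β := β) (θ := θ) (K := K)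
      (B := B) (v₀ := v₀) hF.norm_le hρ k
    exact ⟨_, fun j x => abs_lyapunov_le (hC j x).1 (hC j x).2⟩
  have hmeas : ∀ k, Measurable fun p : (ℕ → S) × (ℕ → ℕ) => lyapunov A
      ((centredIterate F A β θ K B v₀ p.2 k).1 p.1)
      ((centredIterate F A β θ K B v₀ p.2 k).2 p.1) := fun k => by
    obtain ⟨h1, h2⟩ := hF.measurable_centredIterate (A := A) (β := β) (θ := θ) (K := K)
      (B := B) (v₀ := v₀) hρ k
    exact ((h1.norm.pow_const 2).add ((h1.inner h2).const_mul 2)).add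
      ((h2.inner (A.continuous.measurable.comp h2)).const_mul 12)
  have hfub : ∀ k, ∫ ω, lyapunov A
        ((centredIterate F A β θ K B v₀ (fun k => J k ω) k).1 fun k => X k ω)
        ((centredIterate F A β θ K B v₀ (fun k => J k ω) k).2 fun k => X k ω) ∂μ =
      ∫ ω, G k (fun i => J i ω) ∂μ := fun k => by
    obtain ⟨C, hC⟩ := hbound k
    exact integral_path_levels_eq hX.measurable_path hJm hXJ (hmeas k) fun p => hC p.2 p.1
  rw [hfub]
  have hJ' : Measurable fun ω k => J k ω := measurable_pi_lambda _ hJm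
  have hGm : ∀ k, Measurable (G k) := fun k =>
    ((hmeas k).stronglyMeasurable.integral_prod_left').measurable
  have hGb : ∀ k, ∃ C, ∀ j, |G k j| ≤ C := fun k => by
    obtain ⟨C, hC⟩ := hbound k
    exact ⟨C, fun j => abs_integral_le_of_abs_le (hC j)⟩
  induction N with
  | zero => simp [hG, centredIterate]
  | succ k ih =>
    obtain ⟨C, hC⟩ := hGb (k + 1)
    obtain ⟨C', hC'⟩ := hGb k
    have h1 := integral_eq_integral_levelMean (k := k) (K := K) hJm hJ hind
      (H := fun j l => G (k + 1) (Function.update j k l)) (fun j l => hC _)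
      (fun j j' h => by
        funext l
        have : centredIterate F A β θ K B v₀ (Function.update j k l) (k + 1) =
            centredIterate F A β θ K B v₀ (Function.update j' k l) (k + 1) :=
          centredIterate_congr fun i hi => by
            by_cases hik : i = k
            · simp [hik]
            · rw [Function.update_of_ne hik, Function.update_of_ne hik]
              exact h i (Set.mem_Iio.2 (by omega))
        simp only [hG, this])
      (fun j l hl => by
        simp only [hG, centredIterate_update_succ, multilevelError_of_notMem hl])
    simp only [Function.update_eq_self] at h1
    rw [h1]
    have hmono : ∫ ω, levelMean K (fun l => G (k + 1) (Function.update (fun i => J i ω) k l)) ∂μ ≤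
        ∫ ω, (1 - β / 2) * G k (fun i => J i ω) ∂μ := by
      refine integral_mono ?_ ((integrable_of_measurable_of_abs_le ((hGm k).comp hJ')
        fun ω => hC' _).const_mul _) fun ω => ?_
      · have hi : ∀ l, Integrable (fun ω => G (k + 1) (Function.update (fun i => J i ω) k l)) μ :=
          fun l => integrable_of_measurable_of_abs_le ((hGm (k + 1)).comp
            (measurable_pi_lambda _ fun i => by
              by_cases hik : i = k
              · subst hik; simp
              · simp only [Function.update_of_ne hik]; exact hJm i)) fun ω => hC _
        exact (integrable_finsetSum _ fun l _ => (hi l).const_mul _).add ((hi _).const_mul _)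
      · exact hF.levelMean_integral_centredIterate_le hρ hX hQ hτ hA hβ0 hβ hA0 hAβ hAn hθ hFV hAV
          hv₀ hV hB hκ hσ _ k
    refine hmono.trans ?_
    rw [integral_const_mul, pow_succ', mul_assoc]
    exact mul_le_mul_of_nonneg_left ih (by linarith)

end Contraction

/-! ### The parameters -/

section Parameters

open scoped RealInnerProductSpace

/-- The levels admitted by the cutoff `M` are those up to `K = ⌊log₂ M⌋`. -/
theorem two_pow_le_iff_le_floor_logb {M : ℝ} (hM : 1 ≤ M) (j : ℕ) :
    (2 : ℝ) ^ j ≤ M ↔ j ≤ ⌊Real.logb 2 M⌋₊ := by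
  rw [Nat.le_floor_iff (Real.logb_nonneg (by norm_num) hM),
    Real.le_logb_iff_rpow_le (by norm_num) (by linarith), Real.rpow_natCast]

/-- The bound on the step size and the choice of `M` and `B` make the relative bias of the
multilevel estimator at most `1 / 10` and `β` times its relative variance at most `1 / 60`. -/
theorem multilevel_constants_le {m γ ρ β M : ℝ} {τ b K B : ℕ} (hm : 0 < m) (hβ0 : 0 < β)
    (hβ : 12 * β ^ 2 = m * γ) (hρ : 0 ≤ ρ) (hb : 1 ≤ b)
    (hγ : γ * (1800 * ρ ^ 2 * ((τ : ℝ) * (b : ℝ)⁻¹ + (τ : ℝ) ^ 2 * ((b : ℝ) ^ 2)⁻¹)) ^ 2 < m ^ 3)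
    (hM0 : 0 < M) (hM : 1 ≤ M ^ 2 * (2 * β)) (hMK : M ≤ 2 * 2 ^ K) (hK : 1 ≤ K) (hBK : b * K ≤ B) :
    8 / 3 * τ * (ρ / m) / ((2 : ℝ) ^ K * B) ≤ 1 / 10 ∧
      β * (19 / 3 * τ * (ρ / m) ^ 2 * (2 + 12 * K) / B) ≤ 1 / 60 := by
  have hb' : (0 : ℝ) < b := by exact_mod_cast hb
  have hK' : (1 : ℝ) ≤ K := by exact_mod_cast hK
  have hBK' : (b : ℝ) * K ≤ B := by exact_mod_cast hBK
  have hbB : (b : ℝ) ≤ B := by nlinarith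
  have hB' : (0 : ℝ) < B := by linarith
  set r := ρ / m with hr
  have hr0 : 0 ≤ r := by positivity
  have hρr : ρ = r * m := by rw [hr]; field_simp
  set t : ℝ := τ / b with ht
  have ht0 : 0 ≤ t := by positivity
  have hk : (τ : ℝ) * (b : ℝ)⁻¹ + (τ : ℝ) ^ 2 * ((b : ℝ) ^ 2)⁻¹ = t + t ^ 2 := by
    rw [ht]; field_simp
  rw [hk, hρr] at hγ
  -- the bound on `γ`, multiplied by `m` to bring in `m γ = 12 β²`, and `6200 ^ 2 < 12 * 1800 ^ 2`
  have hR : 6200 * (β * (r ^ 2 * (t + t ^ 2))) ≤ 1 := by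
    by_contra hc
    push Not at hc
    have h1 : 1 < (6200 * (β * (r ^ 2 * (t + t ^ 2)))) ^ 2 := by nlinarith
    have h2 : m * (γ * (1800 * (r * m) ^ 2 * (t + t ^ 2)) ^ 2) < m * m ^ 3 := by gcongr
    have h3 : m * (γ * (1800 * (r * m) ^ 2 * (t + t ^ 2)) ^ 2) =
        m ^ 4 * (12 * 1800 ^ 2 * (β * (r ^ 2 * (t + t ^ 2))) ^ 2) := by
      linear_combination (-(1800 * (r * m) ^ 2 * (t + t ^ 2)) ^ 2) * hβ
    have h4 : m ^ 4 * (12 * 1800 ^ 2 * (β * (r ^ 2 * (t + t ^ 2))) ^ 2) < m ^ 4 * 1 := by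
      rw [← h3]; linarith
    have h5 := lt_of_mul_lt_mul_left h4 (by positivity)
    nlinarith [sq_nonneg (β * (r ^ 2 * (t + t ^ 2)))]
  have hR1 : 0 ≤ β * (r ^ 2 * t) := by positivity
  have hR2 : 0 ≤ β * (r ^ 2 * t ^ 2) := by positivity
  constructor
  · have h1 : 8 / 3 * τ * r / ((2 : ℝ) ^ K * B) ≤ 16 / 3 * (r * t) / M := by
      have e : 16 / 3 * (r * t) / M = 8 / 3 * τ * r / (M / 2 * b) := by
        rw [ht]; field_simp; ring
      rw [e]
      have : M / 2 * b ≤ (2 : ℝ) ^ K * B :=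
        mul_le_mul (by linarith) hbB hb'.le (by positivity)
      gcongr
    refine h1.trans (abs_le_of_sq_le_sq' ?_ (by norm_num)).2
    rw [div_pow, div_le_iff₀ (by positivity)]
    have h2 : (r * t) ^ 2 ≤ (r * t) ^ 2 * (M ^ 2 * (2 * β)) :=
      le_mul_of_one_le_right (sq_nonneg _) hM
    have h3 : β * (r ^ 2 * t ^ 2) * M ^ 2 ≤ 1 / 6200 * M ^ 2 :=
      mul_le_mul_of_nonneg_right (by linarith) (sq_nonneg _)
    nlinarith
  · have h1 : (2 + 12 * K : ℝ) / B ≤ 14 / b := by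
      rw [div_le_div_iff₀ hB' hb']
      nlinarith
    calc β * (19 / 3 * τ * r ^ 2 * (2 + 12 * K) / B)
        = β * (19 / 3 * τ * r ^ 2) * ((2 + 12 * K) / B) := by ring
      _ ≤ β * (19 / 3 * τ * r ^ 2) * (14 / b) := by gcongr
      _ = 266 / 3 * (β * (r ^ 2 * t)) := by rw [ht]; ring
      _ ≤ 1 / 60 := by linarith

end Parameters

/-! ### The algorithm in centred coordinates -/

section Coupling

open scoped RealInnerProductSpace

variable {n : ℕ}

/-- The vectors of zero coordinate sum. -/
def zeroSum (n : ℕ) : Submodule ℝ (EuclideanSpace ℝ (Fin n)) where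
  carrier := {v | ∑ i, v i = 0}
  add_mem' {v w} hv hw := by
    simp only [Set.mem_ofPred_eq] at hv hw ⊢
    simp [Finset.sum_add_distrib, hv, hw]
  zero_mem' := by simp
  smul_mem' c v hv := by
    simp only [Set.mem_ofPred_eq] at hv ⊢
    simp [← Finset.mul_sum, hv]

theorem mem_zeroSum {v : EuclideanSpace ℝ (Fin n)} : v ∈ zeroSum n ↔ ∑ i, v i = 0 := Iff.rfl

theorem sub_averageVec_mem_zeroSum (hn : n ≠ 0) (x : EuclideanSpace ℝ (Fin n)) :
    x - averageVec x ∈ zeroSum n := by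
  rw [mem_zeroSum]
  simp [Finset.sum_sub_distrib, sum_averageVec hn]

theorem scaledOp_mem_zeroSum {W : Matrix (Fin n) (Fin n) ℝ} (h : (fun _ => (1 : ℝ)) ᵥ* W = 0)
    (c : ℝ) (v : EuclideanSpace ℝ (Fin n)) : scaledOp c W v ∈ zeroSum n := by
  rw [scaledOp_apply]
  exact (zeroSum n).smul_mem _ (sum_mulVecE_eq_zero h v)

theorem IsGossipMatrix.one_vecMul {G : SimpleGraph (Fin n)} {W : Matrix (Fin n) (Fin n) ℝ}
    (hG : IsGossipMatrix G W) (hW : W.IsHermitian) : (fun _ => (1 : ℝ)) ᵥ* W = 0 := by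
  have h1 : Wᵀ = W := by simpa using hW.eq
  rw [← Matrix.mulVec_transpose, h1]
  exact (hG.ker_eq _).2 fun _ _ => rfl

/-- Relative to the average, the states of the algorithm are those of the centred iteration. -/
theorem accIterate_eq_centredIterate {WG : Set (Matrix (Fin n) (Fin n) ℝ)}
    {Wt : Matrix (Fin n) (Fin n) ℝ} {m γ θ η β p M : ℝ} {K B : ℕ} (hm : m ≠ 0) (hβ : β ≠ 0)
    (hp : p = 1 / 4) (hγ : 12 * β ^ 2 = m * γ) (hη : η = β⁻¹) (hθ : θ * (4 - β ^ 2) = 4 - β)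
    (hB : B ≠ 0) (hK : ∀ j : ℕ, (2 : ℝ) ^ j ≤ M ↔ j ≤ K) {xs : EuclideanSpace ℝ (Fin n)}
    (hxs : ∀ w ∈ WG, mulVecE w xs = 0) (x₀ : EuclideanSpace ℝ (Fin n)) (x : ℕ → WG) (j : ℕ → ℕ)
    (k : ℕ) :
    (accIterate γ θ η β p M B x₀ (fun k => (x k : Matrix (Fin n) (Fin n) ℝ)) j k).x - xs =
      (centredIterate (fun w : WG => scaledOp m ((w : Matrix (Fin n) (Fin n) ℝ) - Wt))
        (scaledOp m Wt) β θ K B (x₀ - xs) j k).1 x ∧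
    (accIterate γ θ η β p M B x₀ (fun k => (x k : Matrix (Fin n) (Fin n) ℝ)) j k).xf - xs =
      (centredIterate (fun w : WG => scaledOp m ((w : Matrix (Fin n) (Fin n) ℝ) - Wt))
        (scaledOp m Wt) β θ K B (x₀ - xs) j k).2 x ∧
    (accIterate γ θ η β p M B x₀ (fun k => (x k : Matrix (Fin n) (Fin n) ℝ)) j k).T =
      ∑ i ∈ Finset.range k, 2 ^ j i * B := by
  induction k with
  | zero => exact ⟨rfl, rfl, by simp [accIterate]⟩
  | succ k ih =>
    set F := fun w : WG => scaledOp m ((w : Matrix (Fin n) (Fin n) ℝ) - Wt) with hF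
    obtain ⟨h1, h2, h3⟩ := ih
    rw [accIterate, Finset.sum_range_succ]
    set s := accIterate γ θ η β p M B x₀ (fun k => (x k : Matrix (Fin n) (Fin n) ℝ)) j k
    have hy : θ • s.xf + (1 - θ) • s.x - xs =
        centredPoint F (scaledOp m Wt) β θ K B (x₀ - xs) j k x := by
      rw [centredPoint, ← h1, ← h2]
      module
    have hg := mlmcEstimate_eq (Wt := Wt) hm hxs x s.T hB (hK (j k)) _
      (centredPoint F (scaledOp m Wt) β θ K B (x₀ - xs) j k) hy
    have e1 : p * γ * m = 3 * β ^ 2 := by rw [hp]; linarith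
    have c1 : (η + (1 - p) * β - β) * θ + (p - η) = 0 := by
      rw [hp, hη]; field_simp; linear_combination hθ
    have c2 : (η + (1 - p) * β - β) * (1 - θ) + (1 - p) * (1 - β) - (1 - β) = 0 := by
      rw [hp] at c1 ⊢; linear_combination -c1
    have c3 : η * (p * γ * m) - 3 * β = 0 := by
      rw [e1, hη]; field_simp; ring
    rw [centredIterate_succ, ← h3]
    simp only [accStep, hg]
    set y := centredPoint F (scaledOp m Wt) β θ K B (x₀ - xs) j k with hyd
    set g := scaledOp m Wt (y x) + multilevelError F K B s.T y (j k) x with hgd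
    have hyx : y x = θ • (s.xf - xs) + (1 - θ) • (s.x - xs) := by rw [← hy]; module
    refine ⟨?_, ?_, trivial⟩
    · rw [← h1]
      -- the error is regrouped into the estimate `g`; then the coefficients of `s.xf`, `s.x` and
      -- `g` are compared
      have e2 : y x + (1 - β) • (s.x - xs - y x) - (3 * β) • scaledOp m Wt (y x) -
          (3 * β) • multilevelError F K B s.T y (j k) x =
          y x + (1 - β) • (s.x - xs - y x) - (3 * β) • g := by rw [hgd]; module
      rw [e2, hyx, ← sub_eq_zero]
      have e3 : η • (θ • s.xf + (1 - θ) • s.x - (p * γ) • m • g) + (p - η) • s.xf +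
          ((1 - p) * (1 - β)) • s.x + ((1 - p) * β) • (θ • s.xf + (1 - θ) • s.x) - xs -
          (θ • (s.xf - xs) + (1 - θ) • (s.x - xs) +
            (1 - β) • (s.x - xs - (θ • (s.xf - xs) + (1 - θ) • (s.x - xs))) - (3 * β) • g) =
          ((η + (1 - p) * β - β) * θ + (p - η)) • s.xf +
          ((η + (1 - p) * β - β) * (1 - θ) + (1 - p) * (1 - β) - (1 - β)) • s.x -
          (η * (p * γ * m) - 3 * β) • g := by module
      rw [e3, c1, c2, c3]
      simp
    · have e4 : y x - (3 * β ^ 2) • scaledOp m Wt (y x) -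
          (3 * β ^ 2) • multilevelError F K B s.T y (j k) x = y x - (3 * β ^ 2) • g := by
        rw [hgd]; module
      rw [e4, ← hy, smul_smul, e1]
      module

/-- The objective is the quadratic form of `W` at the deviation from the average, as `W` vanishes at
the average. -/
theorem consensusObj_eq_inner_sub {G : SimpleGraph (Fin n)} {W : Matrix (Fin n) (Fin n) ℝ}
    (hW : W.PosSemidef) (hG : IsGossipMatrix G W) {m : ℝ} (hm : m ≠ 0)
    (x₀ z : EuclideanSpace ℝ (Fin n)) :
    consensusObj W z =
      m * ⟪z - averageVec x₀, scaledOp m W (z - averageVec x₀)⟫ := by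
  have h0 : Matrix.toEuclideanCLM (𝕜 := ℝ) W (averageVec x₀) = 0 := hG.mulVecE_averageVec x₀
  rw [hW.consensusObj_eq, scaledOp_apply, real_inner_smul_right, mul_inv_cancel_left₀ hm, mulVecE,
    map_sub, h0, sub_zero, inner_sub_left, ← hW.1.inner_toEuclideanCLM_comm (averageVec x₀), h0,
    inner_zero_left, sub_zero]

end Coupling

section Parameters

/-- The momentum parameters expressed through `β` alone. -/
theorem momentum_parameters {m γ p β η θ : ℝ} (hm : 0 < m) (hγ : 0 < γ) (hmγ : m * γ < 3 / 4)
    (hp : p = 1 / 4) (hβ : β = √(4 * p ^ 2 * m * γ / 3)) (hη : η = 3 * β / (p * m * γ))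
    (hθ : θ = (p * η⁻¹ - 1) / (β * p * η⁻¹ - 1)) :
    0 < β ∧ 12 * β ^ 2 = m * γ ∧ β ≤ 1 / 4 ∧ η = β⁻¹ ∧ θ * (4 - β ^ 2) = 4 - β ∧
      √(p ^ 2 * m * γ / 3) = β / 2 := by
  subst hp
  have h0 : 0 < 4 * (1 / 4 : ℝ) ^ 2 * m * γ / 3 := by positivity
  have hβ0 : 0 < β := hβ ▸ Real.sqrt_pos.2 h0
  have hβ2 : 12 * β ^ 2 = m * γ := by rw [hβ, Real.sq_sqrt h0.le]; ring
  have hβ4 : β ≤ 1 / 4 := (abs_le_of_sq_le_sq' (by nlinarith) (by norm_num)).2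
  have hη' : η = β⁻¹ := by
    rw [hη, mul_assoc, ← hβ2]; field_simp; norm_num
  refine ⟨hβ0, hβ2, hβ4, hη', ?_, ?_⟩
  · rw [hθ, hη', inv_inv]
    have : β * (1 / 4) * β - 1 ≠ 0 := by nlinarith
    rw [div_mul_eq_mul_div, div_eq_iff this]
    ring
  · rw [Real.sqrt_eq_iff_mul_self_eq (by positivity) (by positivity)]
    linear_combination -hβ2 / 48

end Parameters

/-! ### The convergence rate -/

section Rate

open scoped RealInnerProductSpace

theorem mainTheorem1 :
    ∃ C : ℝ, 0 < C ∧
      ∀ (n : ℕ) (_ : 2 ≤ n)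
        -- the set of possible gossip matrices, with a σ-field making the entries measurable
        (WG : Set (Matrix (Fin n) (Fin n) ℝ)) (_ : MeasurableSpace WG)
        (_ : ∀ i j, Measurable fun w : WG => (w : Matrix (Fin n) (Fin n) ℝ) i j)
        (_ : ∀ w ∈ WG, ∃ G : SimpleGraph (Fin n), IsGossipMatrix G w)
        (_ : ∀ w ∈ WG, (fun _ => (1 : ℝ)) ᵥ* w = 0)
        -- the chain of gossip matrices
        (Q : Kernel WG WG) (_ : IsMarkovKernel Q) (π : Measure WG)
        (Ω : Type*) (_ : MeasurableSpace Ω) (μ : Measure Ω) (_ : IsProbabilityMeasure μ)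
        (X : ℕ → Ω → WG) (_ : IsStationaryMarkovChain X Q π μ)
        (τ : ℕ) (_ : 1 ≤ τ) (_ : IsUniformlyGeometricallyErgodic Q τ)
        -- the mean matrix
        (Wt : Matrix (Fin n) (Fin n) ℝ)
        (_ : ∀ i j, ∫ w : WG, (w : Matrix (Fin n) (Fin n) ℝ) i j ∂π = Wt i j)
        (_ : Wt.PosSemidef)
        (_ : ∃ Gt : SimpleGraph (Fin n), Gt.Connected ∧ IsGossipMatrix Gt Wt)
        (ρ : ℝ) (_ : ∀ w ∈ WG, spectralNorm2 (w - Wt) ≤ ρ)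
        -- the levels: i.i.d. geometric on {1, 2, …}, independent of the chain
        (J : ℕ → Ω → ℕ) (_ : ∀ k, Measurable (J k))
        (_ : ∀ k j, 1 ≤ j → μ {ω | J k ω = j} = (1 / 2 : ℝ≥0∞) ^ j)
        (_ : iIndepFun J μ)
        (_ : IndepFun (fun ω k => X k ω) (fun ω k => J k ω) μ)
        -- the parameters
        (b : ℕ) (_ : 1 ≤ b) (γ : ℝ) (_ : 0 < γ)
        (_ : γ < 3 / (4 * lambdaMax Wt))
        (_ : γ * (1800 * ρ ^ 2 * ((τ : ℝ) * (b : ℝ)⁻¹ + (τ : ℝ) ^ 2 * ((b : ℝ) ^ 2)⁻¹)) ^ 2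
          < lambdaMinPos Wt ^ 3)
        (p β η θ M : ℝ) (B : ℕ)
        (_ : p = 1 / 4)
        (_ : β = √(4 * p ^ 2 * lambdaMinPos Wt * γ / 3))
        (_ : η = 3 * β / (p * lambdaMinPos Wt * γ))
        (_ : θ = (p * η⁻¹ - 1) / (β * p * η⁻¹ - 1))
        (_ : M = max 2 (√(1 / 4 * (1 + 2 / β))))
        (_ : B = ⌈(b : ℝ) * Real.logb 2 M⌉₊)
        (x₀ : EuclideanSpace ℝ (Fin n)) (N : ℕ),
        let r := consensusObj Wt
        let xs := averageVec x₀
        let s := fun ω =>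
          accIterate γ θ η β p M B x₀ (fun k => (X k ω : Matrix (Fin n) (Fin n) ℝ))
            (fun k => J k ω) N
        let L := fun ω =>
          ‖(s ω).x - xs‖ ^ 2 + 24 / lambdaMinPos Wt * (r (s ω).xf - r xs)
        Integrable L μ ∧
          ∫ ω, L ω ∂μ ≤ C * Real.exp (-(N * √(p ^ 2 * lambdaMinPos Wt * γ / 3))) *
            (‖x₀ - xs‖ ^ 2 + 24 / lambdaMinPos Wt * (r x₀ - r xs)) := by
  -- `5 ≥ 12 / 5 * 2`, where `12 / 5` and `2` compare the Lyapunov function with the quantity to be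
  -- bounded, at the end and at the start
  refine ⟨5, by norm_num, ?_⟩
  intro n hn WG _ hmeas hgossip hone Q _ π Ω _ μ _ X hX τ hτ hQ Wt hmean hW ⟨Gt, _, hG⟩ ρ hρ J hJm
    hJ hind hXJ b hb γ hγ0 hγ1 hγ2 p β η θ M B hp hβ hη hθ hM hB x₀ N r xs s L
  have := hX.isProbabilityMeasure
  have hm := hW.lambdaMinPos_pos hn hG
  have hml := hW.lambdaMinPos_le_lambdaMax hn hG
  set m := lambdaMinPos Wt with hm_def
  have hl : 0 < lambdaMax Wt := hm.trans_le hml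
  have hlγ : lambdaMax Wt * γ < 3 / 4 := by
    rw [lt_div_iff₀ (by positivity)] at hγ1
    linarith
  have hmγ : m * γ < 3 / 4 := (mul_le_mul_of_nonneg_right hml hγ0.le).trans_lt hlγ
  obtain ⟨hβ0, hβ2, hβ4, hηβ, hθβ, hrate⟩ := momentum_parameters hm hγ0 hmγ hp hβ hη hθ
  have hρ0 : 0 ≤ ρ := by
    obtain ⟨ω⟩ := nonempty_of_isProbabilityMeasure μ
    exact (norm_nonneg _).trans (hρ _ (X 0 ω).2)
  have hM2 : 2 ≤ M := hM ▸ le_max_left _ _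
  have hMβ : 1 ≤ M ^ 2 * (2 * β) := by
    have h1 : 1 / 4 * (1 + 2 / β) ≤ M ^ 2 := Real.sqrt_le_left (by linarith) |>.1
      (hM ▸ le_max_right _ _)
    have h2 : 1 / 4 * (1 + 2 / β) * (2 * β) = 1 + β / 2 := by field_simp; ring
    have h3 := mul_le_mul_of_nonneg_right h1 (by positivity : 0 ≤ 2 * β)
    linarith
  have hlev := two_pow_le_iff_le_floor_logb (M := M) (by linarith)
  set K := ⌊Real.logb 2 M⌋₊ with hK_def
  have hK : 1 ≤ K := (hlev 1).1 (by simpa using hM2)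
  have hMK : M ≤ 2 * 2 ^ K := by
    have : ¬ (2 : ℝ) ^ (K + 1) ≤ M := fun h => by have := (hlev _).1 h; omega
    rw [pow_succ] at this
    linarith
  have hBK : b * K ≤ B := by
    have h1 : (K : ℝ) ≤ Real.logb 2 M :=
      Nat.floor_le (Real.logb_nonneg (by norm_num) (by linarith))
    have h2 : (b : ℝ) * K ≤ B := by
      rw [hB]
      exact (mul_le_mul_of_nonneg_left h1 b.cast_nonneg).trans (Nat.le_ceil _)
    exact_mod_cast h2
  have hB0 : B ≠ 0 := by
    have := Nat.mul_pos hb hK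
    omega
  obtain ⟨hκ, hσ⟩ := multilevel_constants_le hm hβ0 hβ2 hρ0 hb hγ2 (by linarith) hMβ hMK hK hBK
  have hn0 : n ≠ 0 := by omega
  set A := scaledOp m Wt with hA_def
  set F := fun w : WG => scaledOp m ((w : Matrix (Fin n) (Fin n) ℝ) - Wt) with hF_def
  have hF : IsCenteredNoise F π (ρ / m) := isCenteredNoise_scaledOp hmeas hmean hρ hm
  have hρm : 0 ≤ ρ / m := by positivity
  have hA : ∀ v w, ⟪A v, w⟫ = ⟪v, A w⟫ := fun v w => by
    rw [hA_def, scaledOp_apply, scaledOp_apply, real_inner_smul_left, real_inner_smul_right,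
      mulVecE, mulVecE, hW.1.inner_toEuclideanCLM_comm]
  have hAi : ∀ v, ⟪v, A v⟫ = m⁻¹ * ⟪v, Matrix.toEuclideanCLM (𝕜 := ℝ) Wt v⟫ := fun v => by
    rw [hA_def, scaledOp_apply, real_inner_smul_right, mulVecE]
  have hA0 : ∀ v, 0 ≤ ⟪v, A v⟫ := fun v => by
    rw [hAi]
    exact mul_nonneg (inv_nonneg.2 hm.le) (hW.inner_toEuclideanCLM_nonneg v)
  -- `16 β² λ_max / λ_min = (4/3) γ λ_max ≤ 1`
  have hstep : ∀ a c : ℝ, 0 ≤ c → a ≤ lambdaMax Wt * c → 16 * β ^ 2 * (m⁻¹ * a) ≤ c :=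
    fun a c hc hac => by
      have e : 16 * β ^ 2 * (m⁻¹ * a) = 4 / 3 * γ * a := by
        field_simp
        linear_combination 4 * a * hβ2
      rw [e]
      have := mul_le_mul_of_nonneg_left hac (by positivity : 0 ≤ 4 / 3 * γ)
      have := mul_le_mul_of_nonneg_right hlγ.le hc
      linarith
  have hAβ : ∀ v, 16 * β ^ 2 * ⟪v, A v⟫ ≤ ‖v‖ ^ 2 := fun v => by
    rw [hAi]
    exact hstep _ _ (sq_nonneg _) (hW.inner_toEuclideanCLM_le v)
  have hAn : ∀ v, 16 * β ^ 2 * ‖A v‖ ≤ ‖v‖ := fun v => by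
    rw [hA_def, scaledOp_apply, norm_smul, Real.norm_of_nonneg (inv_nonneg.2 hm.le)]
    exact hstep _ _ (norm_nonneg _) (hW.norm_toEuclideanCLM_le hl.le v)
  have hoWt := hG.one_vecMul hW.1
  have hAV : ∀ v, A v ∈ zeroSum n := scaledOp_mem_zeroSum hoWt m
  have hFV : ∀ w v, F w v ∈ zeroSum n := fun w v =>
    scaledOp_mem_zeroSum (by rw [Matrix.vecMul_sub, hone _ w.2, hoWt, sub_zero]) m v
  have hV : ∀ v ∈ zeroSum n, ‖v‖ ^ 2 ≤ ⟪v, A v⟫ := fun v hv => by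
    rw [hAi, le_inv_mul_iff₀ hm]
    exact hW.lambdaMinPos_mul_le hG (mem_zeroSum.1 hv)
  have hv₀ : x₀ - xs ∈ zeroSum n := sub_averageVec_mem_zeroSum hn0 x₀
  have hxs : ∀ w ∈ WG, mulVecE w xs = 0 := fun w hw => by
    obtain ⟨G, hwG⟩ := hgossip w hw
    exact hwG.mulVecE_averageVec x₀
  have hobj : ∀ z, 24 / m * (r z - r xs) = 24 * ⟪z - xs, A (z - xs)⟫ := fun z => by
    have h1 : r z = m * ⟪z - xs, A (z - xs)⟫ := consensusObj_eq_inner_sub hW hG hm.ne' x₀ z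
    have h2 : r xs = m * ⟪xs - xs, A (xs - xs)⟫ := consensusObj_eq_inner_sub hW hG hm.ne' x₀ xs
    rw [h1, h2, sub_self, inner_zero_left, mul_zero, sub_zero]
    field_simp
  set v := fun j : ℕ → ℕ => centredIterate F A β θ K B (x₀ - xs) j N with hv
  have hL : ∀ ω, L ω = ‖(v fun k => J k ω).1 fun k => X k ω‖ ^ 2 +
      24 * ⟪(v fun k => J k ω).2 fun k => X k ω, A ((v fun k => J k ω).2 fun k => X k ω)⟫ :=
    fun ω => by
      obtain ⟨h1, h2, -⟩ := accIterate_eq_centredIterate (Wt := Wt) hm.ne' hβ0.ne' hp hβ2 hηβ hθβ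
        hB0 hlev hxs x₀ (fun k => X k ω) (fun k => J k ω) N
      simp only [L]
      rw [hobj, h1, h2]
  obtain ⟨C, hC⟩ := exists_norm_centredIterate_le (A := A) (β := β) (θ := θ) (K := K) (B := B)
    (v₀ := x₀ - xs) hF.norm_le hρm N
  obtain ⟨g1, g2⟩ := hF.measurable_centredIterate (A := A) (β := β) (θ := θ) (K := K) (B := B)
    (v₀ := x₀ - xs) hρm N
  have hXJm : Measurable fun ω => ((fun k => X k ω, fun k => J k ω) : (ℕ → WG) × (ℕ → ℕ)) :=
    hX.measurable_path.prodMk (measurable_pi_lambda _ hJm)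
  have m1 := g1.comp hXJm
  have m2 := g2.comp hXJm
  have m3 := A.continuous.measurable.comp m2
  have hLmeas : Measurable L := by
    have : L = _ := funext hL
    rw [this]
    exact (m1.norm.pow_const 2).add ((m2.inner m3).const_mul 24)
  have hVint : Integrable (fun ω => lyapunov A ((v fun k => J k ω).1 fun k => X k ω)
      ((v fun k => J k ω).2 fun k => X k ω)) μ :=
    integrable_of_measurable_of_abs_le
      (((m1.norm.pow_const 2).add ((m1.inner m2).const_mul 2)).add ((m2.inner m3).const_mul 12))
      fun ω => abs_lyapunov_le (hC _ _).1 (hC _ _).2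
  have hL0 : ∀ ω, 0 ≤ L ω := fun ω => by
    rw [hL]
    have := hA0 ((v fun k => J k ω).2 fun k => X k ω)
    positivity
  have hLV : ∀ ω, L ω ≤ 12 / 5 * lyapunov A ((v fun k => J k ω).1 fun k => X k ω)
      ((v fun k => J k ω).2 fun k => X k ω) := fun ω => by
    have hmem := (centredIterate_mem (β := β) (θ := θ) (K := K) (B := B) hFV hAV hv₀
      (fun k => J k ω) N (fun k => X k ω)).2
    have := half_norm_sq_add_le_lyapunov (A := A) ((v fun k => J k ω).1 fun k => X k ω) _
      (hV _ hmem)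
    rw [hL]
    have := sq_nonneg ‖(v fun k => J k ω).1 fun k => X k ω‖
    linarith
  have hLint : Integrable L μ := (hVint.const_mul (12 / 5)).mono' hLmeas.aestronglyMeasurable
    (ae_of_all _ fun ω => by
      rw [Real.norm_of_nonneg (hL0 ω)]
      exact hLV ω)
  refine ⟨hLint, ?_⟩
  have hmain := hF.integral_lyapunov_centredIterate_le hρm hX hQ hτ hA hβ0.le hβ4 hA0 hAβ hAn hθβ
    hFV hAV hv₀ hV hB0 hκ hσ hJm hJ hind hXJ N
  have hinit := lyapunov_self_le (A := A) (x₀ - xs) (hV _ hv₀)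
  have hpow : (1 - β / 2) ^ N ≤ Real.exp (-(N * (β / 2))) := by
    have h1 : 1 - β / 2 ≤ Real.exp (-(β / 2)) := by
      have := Real.add_one_le_exp (-(β / 2))
      linarith
    calc (1 - β / 2) ^ N ≤ Real.exp (-(β / 2)) ^ N := pow_le_pow_left₀ (by linarith) h1 N
      _ = Real.exp (-(N * (β / 2))) := by rw [← Real.exp_nat_mul]; congr 1; ring
  rw [hrate, hobj]
  set L₀ := ‖x₀ - xs‖ ^ 2 + 24 * ⟪x₀ - xs, A (x₀ - xs)⟫ with hL₀
  have hL₀0 : 0 ≤ L₀ := by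
    have := hA0 (x₀ - xs)
    positivity
  have hinit' : lyapunov A (x₀ - xs) (x₀ - xs) ≤ 2 * L₀ := by
    have := hA0 (x₀ - xs)
    linarith
  have hpow0 : 0 ≤ (1 - β / 2) ^ N := pow_nonneg (by linarith) N
  calc ∫ ω, L ω ∂μ
      ≤ ∫ ω, 12 / 5 * lyapunov A ((v fun k => J k ω).1 fun k => X k ω)
          ((v fun k => J k ω).2 fun k => X k ω) ∂μ :=
        integral_mono hLint (hVint.const_mul _) hLV
    _ = 12 / 5 * ∫ ω, lyapunov A ((v fun k => J k ω).1 fun k => X k ω)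
          ((v fun k => J k ω).2 fun k => X k ω) ∂μ := integral_const_mul _ _
    _ ≤ 12 / 5 * ((1 - β / 2) ^ N * (2 * L₀)) := by
        have := hmain.trans (mul_le_mul_of_nonneg_left hinit' hpow0)
        linarith
    _ ≤ 5 * ((1 - β / 2) ^ N * L₀) := by
        have := mul_nonneg hpow0 hL₀0
        linarith
    _ ≤ 5 * Real.exp (-(N * (β / 2))) * L₀ := by
        have := mul_le_mul_of_nonneg_right hpow hL₀0
        linarith

end Rate
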